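/- Let $\mu$ be a probability measure on $\mathbb{R}$ with Lebesgue density $e^{U}$, where $U:\mathbb{R}\to\mathbb{R}$ is $\mathcal{C}^2$ and strongly concave, let $\pi$ be a probability measure on $\mathbb{R}$, and let $p=p(n)$ be a sequence of non-negative integers with $p(n)/n\to\kappa$ for some $\kappa\in(0,\infty)$. For each $n\ge 1$ let the following be independent: a matrix $\boldsymbol X\in\mathbb{R}^{n\times p}$ with rows $\boldsymbol X_1^\top,\dots,\boldsymbol X_n^\top$ whose entries are i.i.d. $\mathcal N(0,1/n)$; a signal $\boldsymbol\beta_\star\in\mathbb{R}^p$ with i.i.d. coordinates of law $\pi$; and $\boldsymbol e\in\mathbb{R}^n$ with i.i.d. coordinates uniform on $[0,1]$. Let $\sigma(x)=e^x/(1+e^x)$, and for $\delta>0$ let $f_\delta(x)=(\tanh(x/\delta)+1)/2$. Put $$\tilde T_i=\mathbb{I}\{\boldsymbol X_i^\top\boldsymbol\beta_\star\ge\sigma^{-1}(e_i)\},\qquad \tilde T_{\delta,i}=f_\delta\big(\boldsymbol X_i^\top\boldsymbol\beta_\star-\sigma^{-1}(e_i)\big),\qquad i=1,\dots,n.$$ Let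 $\mathbb{P}$ and $\mathbb{P}_\delta$ be the (random) logistic regression posterior and its smoothed version, that is, the probability measures on $\mathbb{R}^p$ $$\mathbb{P}(d\boldsymbol\beta)=\frac1{Z_n}\exp\Big\{\sum_{i=1}^n\big(\tilde T_i\,\boldsymbol X_i^\top\boldsymbol\beta-\log(1+e^{\boldsymbol X_i^\top\boldsymbol\beta})\big)\Big\}\prod_{j=1}^p\mu(d\beta_j),$$ $$\mathbb{P}_\delta(d\boldsymbol\beta)=\frac1{Z_{n,\delta}}\exp\Big\{\sum_{i=1}^n\big(\tilde T_{\delta,i}\,\boldsymbol X_i^\top\boldsymbol\beta-\log(1+e^{\boldsymbol X_i^\top\boldsymbol\beta})\big)\Big\}\prod_{j=1}^p\mu(d\beta_j),$$ and let $\mathbb{P}_{j}$ and $\mathbb{P}_{\delta,j}$ be their $j$-th marginals. Let $W_2$ be the Wasserstein-2 distance on $\mathbb{R}$, $W_2(\nu,\nu')=\inf_\gamma\big(\int|x-y|^2\,\gamma(dx,dy)\big)^{1/2}$, the infimum being over all couplings $\gamma$ of $\nu$ and $\nu'$. Then there is a constant $C>0$, not depending on $n$, $\delta$ or $j_0$,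 such that for all $n\ge1$, all $\delta>0$ and all $j_0\in\{1,\dots,p(n)\}$ $$\mathbb{E}\,W_2^2\big(\mathbb{P}_{j_0},\mathbb{P}_{\delta,j_0}\big)\le C\,\delta^{1/4},$$ where $\mathbb{E}$ is the expectation over $(\boldsymbol X,\boldsymbol\beta_\star,\boldsymbol e)$. -/

import Mathlib

open MeasureTheory ProbabilityTheory Filter Topology
open scoped ENNReal NNReal BigOperators

noncomputable section

namespace LogisticSmoothing

/-- The Wasserstein-2 distance `W₂(μ, ν) = inf_γ (∫ d(x, y)² dγ(x, y))^(1/2)`, the infimum being over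
all couplings `γ` of `μ` and `ν`, with values in `[0, ∞]`. -/
def wasserstein2 {E : Type*} [PseudoEMetricSpace E] [MeasurableSpace E] (μ ν : Measure E) : ℝ≥0∞ :=
  ⨅ γ ∈ {γ : Measure (E × E) | γ.fst = μ ∧ γ.snd = ν}, (∫⁻ z, edist z.1 z.2 ^ 2 ∂γ) ^ (1 / 2 : ℝ)

/-- `μ` is a Borel probability measure on `ℝ` whose Lebesgue density is `exp U` for a `C²` and strongly
concave function `U : ℝ → ℝ`. -/
def IsStronglyLogConcavePrior (μ : Measure ℝ) : Prop :=
  IsProbabilityMeasure μ ∧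
    ∃ U : ℝ → ℝ, ContDiff ℝ 2 U ∧ (∃ m : ℝ, 0 < m ∧ StrongConcaveOn Set.univ m U) ∧
      μ = (volume : Measure ℝ).withDensity (fun x => ENNReal.ofReal (Real.exp (U x)))

/-- The inverse `σ⁻¹` on `(0, 1)` of the sigmoid function `σ(x) = eˣ / (1 + eˣ)`. -/
def logit (t : ℝ) : ℝ := Real.log (t / (1 - t))

theorem sigmoid_eq (x : ℝ) : Real.sigmoid x = Real.exp x / (1 + Real.exp x) := by
  rw [Real.sigmoid_def, Real.exp_neg]
  have := Real.exp_pos x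
  field_simp
  ring

theorem logit_sigmoid (x : ℝ) : logit (Real.sigmoid x) = x := by
  have h := Real.exp_pos x
  have h2 : Real.sigmoid x / (1 - Real.sigmoid x) = Real.exp x := by
    rw [sigmoid_eq]
    field_simp
    ring
  rw [logit, h2, Real.log_exp]

theorem sigmoid_logit {t : ℝ} (h0 : 0 < t) (h1 : t < 1) : Real.sigmoid (logit t) = t := by
  have h : 0 < 1 - t := by linarith
  rw [sigmoid_eq, logit, Real.exp_log (div_pos h0 h)]
  field_simp
  ring

/-- The inner product `Xᵢᵀ b` of the `i`-th row of the design matrix with `b`. -/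
def linPred {n p : ℕ} (X : Fin n → Fin p → ℝ) (b : Fin p → ℝ) (i : Fin n) : ℝ :=
  ∑ j, X i j * b j

/-- The logistic responses `T̃ᵢ(Xᵢᵀ β⋆) = 1{Xᵢᵀ β⋆ ≥ σ⁻¹(eᵢ)}`. -/
def hardResponse {n p : ℕ} (X : Fin n → Fin p → ℝ) (βs : Fin p → ℝ) (e : Fin n → ℝ) (i : Fin n) : ℝ :=
  Set.indicator (Set.Ici (logit (e i))) 1 (linPred X βs i)

/-- The smooth approximation `f_δ(x) = (tanh(x/δ) + 1) / 2` of the indicator of `[0, ∞)`. -/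
def smoothStep (δ x : ℝ) : ℝ := (Real.tanh (x / δ) + 1) / 2

/-- The smoothed responses `T̃_{δ,i}(Xᵢᵀ β⋆) = f_δ(Xᵢᵀ β⋆ - σ⁻¹(eᵢ))`. -/
def smoothResponse (δ : ℝ) {n p : ℕ} (X : Fin n → Fin p → ℝ) (βs : Fin p → ℝ) (e : Fin n → ℝ)
    (i : Fin n) : ℝ :=
  smoothStep δ (linPred X βs i - logit (e i))

/-- The log-likelihood `b ↦ ∑ᵢ (yᵢ Xᵢᵀ b - log(1 + exp(Xᵢᵀ b)))`. -/
def logLik {n p : ℕ} (X : Fin n → Fin p → ℝ) (y : Fin n → ℝ) (b : Fin p → ℝ) : ℝ :=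
  ∑ i, (y i * linPred X b i - Real.log (1 + Real.exp (linPred X b i)))

/-- The posterior `Z⁻¹ exp(logLik X y b) ∏ⱼ μ(dbⱼ)`, where `Z = ∫ exp(logLik X y b) ∏ⱼ μ(dbⱼ)`. -/
def posterior (μ : Measure ℝ) {n p : ℕ} (X : Fin n → Fin p → ℝ) (y : Fin n → ℝ) :
    Measure (Fin p → ℝ) :=
  (Measure.pi fun _ : Fin p => μ).tilted (logLik X y)

/-- The `j`-th marginal of a measure on `ℝᵖ`. -/
def marginal {p : ℕ} (P : Measure (Fin p → ℝ)) (j : Fin p) : Measure ℝ :=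
  P.map fun b => b j

/-- The joint law of `(X, β⋆, e)`: these are independent, the entries of `X` are i.i.d. `N(0, 1/n)`
(so the rows are i.i.d. `N(0, I/n)`), the coordinates of `β⋆` are i.i.d. with law `π`, and the
coordinates of `e` are i.i.d. uniform on `[0, 1]`. -/
def dataLaw (π : Measure ℝ) (n p : ℕ) :
    Measure ((Fin n → Fin p → ℝ) × (Fin p → ℝ) × (Fin n → ℝ)) :=
  (Measure.pi fun _ : Fin n => Measure.pi fun _ : Fin p => gaussianReal 0 ((n : ℝ≥0)⁻¹)).prod
    ((Measure.pi fun _ : Fin p => π).prod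
      (Measure.pi fun _ : Fin n => (volume : Measure ℝ).restrict (Set.Icc 0 1)))

theorem logLik_nonpos {n p : ℕ} (X : Fin n → Fin p → ℝ) (y : Fin n → ℝ)
    (hy : ∀ i, y i ∈ Set.Icc (0 : ℝ) 1) (b : Fin p → ℝ) : logLik X y b ≤ 0 := by
  refine Finset.sum_nonpos fun i _ => ?_
  obtain ⟨h0, h1⟩ := hy i
  set a := linPred X b i
  have hpos : 0 ≤ Real.log (1 + Real.exp a) :=
    Real.log_nonneg (by linarith [Real.exp_pos a])
  have ha : a ≤ Real.log (1 + Real.exp a) := by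
    rw [Real.le_log_iff_exp_le (by linarith [Real.exp_pos a])]
    linarith
  nlinarith

/-- For responses in `[0, 1]` the normalizing constant is finite and positive, so that the posterior is
a genuine probability measure. -/
theorem isProbabilityMeasure_posterior (μ : Measure ℝ) [IsProbabilityMeasure μ] {n p : ℕ}
    (X : Fin n → Fin p → ℝ) (y : Fin n → ℝ) (hy : ∀ i, y i ∈ Set.Icc (0 : ℝ) 1) :
    IsProbabilityMeasure (posterior μ X y) := by
  refine isProbabilityMeasure_tilted ?_
  refine Integrable.of_bound (C := 1) ?_ ?_
  · refine Measurable.aestronglyMeasurable ?_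
    unfold logLik linPred
    fun_prop
  · refine ae_of_all _ fun b => ?_
    rw [Real.norm_eq_abs, Real.abs_exp]
    exact Real.exp_le_one_iff.mpr (logLik_nonpos X y hy b)

theorem hardResponse_mem {n p : ℕ} (X : Fin n → Fin p → ℝ) (βs : Fin p → ℝ) (e : Fin n → ℝ)
    (i : Fin n) : hardResponse X βs e i ∈ Set.Icc (0 : ℝ) 1 := by
  unfold hardResponse Set.indicator
  split_ifs <;> simp

theorem smoothResponse_mem (δ : ℝ) {n p : ℕ} (X : Fin n → Fin p → ℝ) (βs : Fin p → ℝ)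
    (e : Fin n → ℝ) (i : Fin n) : smoothResponse δ X βs e i ∈ Set.Icc (0 : ℝ) 1 := by
  unfold smoothResponse smoothStep
  have h1 := Real.tanh_lt_one ((linPred X βs i - logit (e i)) / δ)
  have h2 := Real.neg_one_lt_tanh ((linPred X βs i - logit (e i)) / δ)
  constructor <;> linarith

end LogisticSmoothing

end

noncomputable section

namespace LogisticSmoothing

/-! ### The Prékopa–Leindler inequality -/

/-! The law of the data is invariant under permutations of the coordinates, so the expected cost of
one marginal is the average over all `p` of them. It therefore suffices to bound the expected sum of
the squared distances between marginals by a multiple of `p * δ ^ (1 / 4)`.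

For fixed data the two posteriors differ by a linear tilt `exp (∑ j, h j * b j)`, where `h` is the
transpose of `X` applied to the difference of the responses. Both are log-concave perturbations of a
product of `m`-strongly log-concave measures, and this gives `∑ j, W₂² ≤ 4 / m² * ∑ j, h j ^ 2`
(`sum_wasserstein2_marginal_posterior_le`). The proof is a duality argument. Monotone rearrangement
supplies Kantorovich potentials `f j`, `g j` for each pair of marginals
(`exists_kantorovich_potentials`). The sums of these potentials over the coordinates, added to the
two log-densities, are fed into a Prékopa–Leindler inequality strengthened by the curvature of the
prior (`hasCurvedPL_pi`). One half of the curvature pays for the potentials, and the other half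
absorbs the tilt by completing a square.

It remains to bound the expectation of `∑ j, h j ^ 2`. Given the signal, each `h j` is a sum of `n`
i.i.d. terms, the gap of a response times an entry of its row. If `D` bounds the second moment of
the gap given the linear predictor, the variances contribute at most `p * D` and, by Bessel's
inequality, the squared means at most `n * D` (`lintegral_sq_gradient_le`). Comparison with a Cauchy
density gives `D ≤ min 1 (π δ)`, which is at most `π δ ^ (1 / 4)`. Finally `n` is at most a constant
times `p`. -/

theorem volume_add_le_of_isCompact {K L W : Set ℝ} (hK : IsCompact K) (hL : IsCompact L)
    (hK0 : K.Nonempty) (hL0 : L.Nonempty) (hW : ∀ a ∈ K, ∀ b ∈ L, (a + b) / 2 ∈ W) :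
    volume K + volume L ≤ 2 * volume W := by
  obtain ⟨s, hs, hsK⟩ := hK.exists_isGreatest hK0
  obtain ⟨t, ht, htL⟩ := hL.exists_isLeast hL0
  have half (A : Set ℝ) (c : ℝ) : volume A = 2 * volume ((fun x : ℝ => 2 * x - c) ⁻¹' A) := by
    have h1 : (fun x : ℝ => 2 * x - c) ⁻¹' A = (fun x => 2 * x) ⁻¹' ((fun x => x - c) ⁻¹' A) := rfl
    have h3 : volume ((fun x => x - c) ⁻¹' A) = volume A := by
      simp_rw [sub_eq_add_neg]
      exact measure_preimage_add_right _ _ _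
    rw [h1, Real.volume_preimage_mul_left two_ne_zero, h3, ← mul_assoc]
    have h2 : (2 : ℝ≥0∞) * ENNReal.ofReal |2⁻¹| = 1 := by
      rw [abs_of_pos (by norm_num), ENNReal.ofReal_inv_of_pos two_pos]
      simp [ENNReal.mul_inv_cancel]
    rw [h2, one_mul]
  -- These are `(K + t) / 2` and `(L + s) / 2`. Since `s = max K` and `t = min L`, they lie on
  -- opposite sides of `(s + t) / 2`, and both are contained in `W`.
  have hd : AEDisjoint volume ((fun x : ℝ => 2 * x - t) ⁻¹' K) ((fun x : ℝ => 2 * x - s) ⁻¹' L) := by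
    refine measure_mono_null (t := {(s + t) / 2}) ?_ (by simp)
    rintro x ⟨h1, h2⟩
    have h3 := hsK h1
    have h4 := htL h2
    simp only [Set.mem_singleton_iff]
    simp only at h3 h4
    linarith
  have hm : MeasurableSet ((fun x : ℝ => 2 * x - s) ⁻¹' L) :=
    (by fun_prop : Measurable fun x : ℝ => 2 * x - s) hL.measurableSet
  rw [half K t, half L s, ← mul_add, ← measure_union₀ hm.nullMeasurableSet hd]
  gcongr
  rintro x (h | h)
  · simpa using hW _ h _ ht
  · simpa using hW _ hs _ h

/-- The one-dimensional Brunn–Minkowski inequality, for midpoints. -/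
theorem volume_add_le_of_midpoint {A B W : Set ℝ} (hA : MeasurableSet A) (hB : MeasurableSet B)
    (hA0 : A.Nonempty) (hB0 : B.Nonempty) (hW : ∀ a ∈ A, ∀ b ∈ B, (a + b) / 2 ∈ W) :
    volume A + volume B ≤ 2 * volume W := by
  obtain ⟨a, ha⟩ := hA0
  obtain ⟨b, hb⟩ := hB0
  -- Inserting the fixed points `a` and `b` removes the nonemptiness assumption, so that inner
  -- regularity can be applied with all compact subsets, the empty one included.
  have key : ∀ K ⊆ A, IsCompact K → ∀ L ⊆ B, IsCompact L →
      volume K + volume L ≤ 2 * volume W := by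
    intro K hK hKc L hL hLc
    refine le_trans (add_le_add (measure_mono (Set.subset_insert a K))
      (measure_mono (Set.subset_insert b L)))
      (volume_add_le_of_isCompact (hKc.insert a) (hLc.insert b) (Set.insert_nonempty _ _)
        (Set.insert_nonempty _ _) ?_)
    intro x hx y hy
    exact hW x (Set.insert_subset ha hK hx) y (Set.insert_subset hb hL hy)
  have h1 : ∀ L ⊆ B, IsCompact L → volume A + volume L ≤ 2 * volume W := by
    intro L hL hLc
    have : volume A ≤ 2 * volume W - volume L := by
      rw [hA.measure_eq_iSup_isCompact]
      refine iSup_le fun K => iSup_le fun hK => iSup_le fun hKc => ?_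
      exact ENNReal.le_sub_of_add_le_right hLc.measure_ne_top (key K hK hKc L hL hLc)
    calc volume A + volume L ≤ 2 * volume W - volume L + volume L := by gcongr
      _ = 2 * volume W := tsub_add_cancel_of_le
          (le_trans le_add_self (key ∅ (Set.empty_subset _) isCompact_empty L hL hLc))
  have h2 : volume A ≤ 2 * volume W := by
    simpa using h1 ∅ (Set.empty_subset _) isCompact_empty
  by_cases hAt : volume A = ⊤
  · rw [hAt, top_le_iff] at h2
    rw [h2]
    exact le_top
  have : volume B ≤ 2 * volume W - volume A := by
    rw [hB.measure_eq_iSup_isCompact]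
    refine iSup_le fun K => iSup_le fun hK => iSup_le fun hKc => ?_
    exact ENNReal.le_sub_of_add_le_left hAt (h1 K hK hKc)
  calc volume A + volume B ≤ volume A + (2 * volume W - volume A) := by gcongr
    _ = 2 * volume W := add_tsub_cancel_of_le h2

theorem mul_le_sq_of_add_le_two_mul {x y z : ℝ≥0∞} (h : x + y ≤ 2 * z) : x * y ≤ z ^ 2 := by
  by_cases hz : z = ⊤
  · simp [hz]
  have hx : x ≠ ⊤ := ne_top_of_le_ne_top (ENNReal.mul_ne_top (by simp) hz) (le_self_add.trans h)
  have hy : y ≠ ⊤ := ne_top_of_le_ne_top (ENNReal.mul_ne_top (by simp) hz) (le_add_self.trans h)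
  lift x to ℝ≥0 using hx
  lift y to ℝ≥0 using hy
  lift z to ℝ≥0 using hz
  norm_cast at h ⊢
  rw [← NNReal.coe_le_coe] at h ⊢
  push_cast at h ⊢
  nlinarith [sq_nonneg ((x : ℝ) - y), x.2, y.2, z.2]

/-- Layer-cake formula: Brunn–Minkowski is applied to the superlevel sets at each height `t`.
Because both suprema equal `1`, these sets are nonempty for the same heights `t < 1` and empty for
`t ≥ 1`. -/
theorem lintegral_add_le_of_normalized {u v w : ℝ → ℝ} (hu : Measurable u) (hv : Measurable v)
    (hw : Measurable w) (hu0 : ∀ x, 0 ≤ u x) (hv0 : ∀ x, 0 ≤ v x) (hw0 : ∀ x, 0 ≤ w x)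
    (hu1 : ∀ x, u x ≤ 1) (hv1 : ∀ x, v x ≤ 1) (hus : ∀ t < 1, ∃ x, t < u x)
    (hvs : ∀ t < 1, ∃ x, t < v x) (h : ∀ x y, u x * v y ≤ w ((x + y) / 2) ^ 2) :
    (∫⁻ x, ENNReal.ofReal (u x)) + ∫⁻ x, ENNReal.ofReal (v x) ≤
      2 * ∫⁻ x, ENNReal.ofReal (w x) := by
  rw [lintegral_eq_lintegral_meas_lt volume (ae_of_all _ hu0) hu.aemeasurable,
    lintegral_eq_lintegral_meas_lt volume (ae_of_all _ hv0) hv.aemeasurable,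
    lintegral_eq_lintegral_meas_lt volume (ae_of_all _ hw0) hw.aemeasurable,
    ← lintegral_const_mul' _ _ (by simp)]
  have hmeas : ∀ f : ℝ → ℝ, Measurable fun t : ℝ => volume {a | t < f a} := fun f =>
    Antitone.measurable fun s t hst => measure_mono fun a ha => lt_of_le_of_lt hst ha
  rw [← lintegral_add_left (hmeas u)]
  refine setLIntegral_mono ((hmeas w).const_mul 2) fun t ht => ?_
  have ht : 0 < t := ht
  rcases lt_or_ge t 1 with h1 | h1
  · refine volume_add_le_of_midpoint (measurableSet_lt measurable_const hu)
      (measurableSet_lt measurable_const hv) (hus t h1) (hvs t h1) fun a ha b hb => ?_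
    simp only [Set.mem_ofPred_eq] at ha hb ⊢
    have := h a b
    refine lt_of_pow_lt_pow_left₀ 2 (hw0 _) (lt_of_lt_of_le ?_ this)
    nlinarith
  · have e1 : {a | t < u a} = ∅ := by
      ext a; simpa using (hu1 a).trans h1
    have e2 : {a | t < v a} = ∅ := by
      ext a; simpa using (hv1 a).trans h1
    simp [e1, e2]

/-- Dividing `u` and `v` by their suprema `a` and `b`, and `w` by `√(a * b)`, preserves the
hypothesis. The additive inequality of the normalized case then becomes multiplicative by AM-GM. -/
theorem prekopaLeindler_of_bounded {u v w : ℝ → ℝ} (hu : Measurable u) (hv : Measurable v)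
    (hw : Measurable w) (hu0 : ∀ x, 0 ≤ u x) (hv0 : ∀ x, 0 ≤ v x) (hw0 : ∀ x, 0 ≤ w x)
    {N : ℝ} (hu1 : ∀ x, u x ≤ N) (hv1 : ∀ x, v x ≤ N)
    (h : ∀ x y, u x * v y ≤ w ((x + y) / 2) ^ 2) :
    (∫⁻ x, ENNReal.ofReal (u x)) * ∫⁻ x, ENNReal.ofReal (v x) ≤
      (∫⁻ x, ENNReal.ofReal (w x)) ^ 2 := by
  have hub : BddAbove (Set.range u) := ⟨N, by rintro _ ⟨x, rfl⟩; exact hu1 x⟩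
  have hvb : BddAbove (Set.range v) := ⟨N, by rintro _ ⟨x, rfl⟩; exact hv1 x⟩
  set a := ⨆ x, u x with ha
  set b := ⨆ x, v x with hb
  have hua : ∀ x, u x ≤ a := fun x => le_ciSup hub x
  have hvb' : ∀ x, v x ≤ b := fun x => le_ciSup hvb x
  have ha0 : 0 ≤ a := (hu0 0).trans (hua 0)
  have hb0 : 0 ≤ b := (hv0 0).trans (hvb' 0)
  rcases ha0.eq_or_lt with ha0 | ha0
  · have : ∀ x, ENNReal.ofReal (u x) = 0 := fun x => by simpa [← ha0] using hua x
    simp [this]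
  rcases hb0.eq_or_lt with hb0 | hb0
  · have : ∀ x, ENNReal.ofReal (v x) = 0 := fun x => by simpa [← hb0] using hvb' x
    simp [this]
  set c := Real.sqrt (a * b) with hc
  have hc0 : 0 < c := Real.sqrt_pos.mpr (mul_pos ha0 hb0)
  have hc2 : c ^ 2 = a * b := Real.sq_sqrt (mul_pos ha0 hb0).le
  have key := lintegral_add_le_of_normalized (u := fun x => a⁻¹ * u x) (v := fun x => b⁻¹ * v x)
    (w := fun x => c⁻¹ * w x) (by fun_prop) (by fun_prop) (by fun_prop)
    (fun x => mul_nonneg (inv_nonneg.mpr ha0.le) (hu0 x))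
    (fun x => mul_nonneg (inv_nonneg.mpr hb0.le) (hv0 x))
    (fun x => mul_nonneg (inv_nonneg.mpr hc0.le) (hw0 x))
    (fun x => by rw [inv_mul_le_iff₀ ha0, mul_one]; exact hua x)
    (fun x => by rw [inv_mul_le_iff₀ hb0, mul_one]; exact hvb' x)
    (fun t ht => by
      obtain ⟨x, hx⟩ := exists_lt_of_lt_ciSup (show a * t < ⨆ x, u x by rw [← ha]; nlinarith)
      exact ⟨x, by rw [lt_inv_mul_iff₀ ha0]; exact hx⟩)
    (fun t ht => by
      obtain ⟨x, hx⟩ := exists_lt_of_lt_ciSup (show b * t < ⨆ x, v x by rw [← hb]; nlinarith)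
      exact ⟨x, by rw [lt_inv_mul_iff₀ hb0]; exact hx⟩)
    (fun x y => by
      have : a⁻¹ * u x * (b⁻¹ * v y) = (c ^ 2)⁻¹ * (u x * v y) := by
        rw [hc2, mul_inv]; ring
      rw [this, mul_pow, inv_pow]
      gcongr
      exact h x y)
  have hmul : ∀ (r : ℝ) (f : ℝ → ℝ), 0 < r →
      ∫⁻ x, ENNReal.ofReal (r⁻¹ * f x) = ENNReal.ofReal r⁻¹ * ∫⁻ x, ENNReal.ofReal (f x) := by
    intro r f hr
    rw [← lintegral_const_mul' _ _ ENNReal.ofReal_ne_top]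
    simp_rw [ENNReal.ofReal_mul (inv_nonneg.mpr hr.le)]
  rw [hmul a u ha0, hmul b v hb0, hmul c w hc0] at key
  have key2 := mul_le_sq_of_add_le_two_mul key
  set I := ∫⁻ x, ENNReal.ofReal (u x)
  set J := ∫⁻ x, ENNReal.ofReal (v x)
  set K := ∫⁻ x, ENNReal.ofReal (w x)
  have e1 : ENNReal.ofReal a⁻¹ * I * (ENNReal.ofReal b⁻¹ * J) =
      ENNReal.ofReal (c ^ 2)⁻¹ * (I * J) := by
    rw [hc2, mul_inv, ENNReal.ofReal_mul (inv_nonneg.mpr ha0.le)]; ring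
  have e2 : (ENNReal.ofReal c⁻¹ * K) ^ 2 = ENNReal.ofReal (c ^ 2)⁻¹ * K ^ 2 := by
    rw [mul_pow, ← ENNReal.ofReal_pow (inv_nonneg.mpr hc0.le), inv_pow]
  rw [e1, e2] at key2
  exact (ENNReal.mul_le_mul_iff_right (by simpa using hc0.ne')
    ENNReal.ofReal_ne_top).mp key2

/-- The Prékopa–Leindler inequality on the line, for midpoints. -/
theorem prekopaLeindler {u v w : ℝ → ℝ≥0∞} (hu : Measurable u) (hv : Measurable v)
    (hw : Measurable w) (h : ∀ x y, u x * v y ≤ w ((x + y) / 2) ^ 2) :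
    (∫⁻ x, u x) * ∫⁻ x, v x ≤ (∫⁻ x, w x) ^ 2 := by
  have sup : ∀ f : ℝ → ℝ≥0∞, Measurable f →
      Tendsto (fun N : ℕ => ∫⁻ x, min (f x) N) atTop (𝓝 (∫⁻ x, f x)) := by
    intro f hf
    refine lintegral_tendsto_of_tendsto_of_monotone (fun N => (hf.min measurable_const).aemeasurable)
      (ae_of_all _ fun x N M hNM => ?_) (ae_of_all _ fun x => ?_)
    · exact min_le_min_left _ (by exact_mod_cast hNM)
    · have := (tendsto_const_nhds (x := f x)).min ENNReal.tendsto_nat_nhds_top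
      simpa using this
  have bdd : ∀ N : ℕ, (∫⁻ x, min (u x) N) * ∫⁻ x, min (v x) N ≤ (∫⁻ x, w x) ^ 2 := by
    intro N
    have tr : ∀ z : ℝ≥0∞, ENNReal.ofReal (min z N).toReal = min z N := fun z =>
      ENNReal.ofReal_toReal (ne_top_of_le_ne_top (ENNReal.natCast_ne_top N) (min_le_right _ _))
    have le : ∀ z : ℝ≥0∞, (min z N).toReal ≤ N := fun z =>
      ENNReal.toReal_le_of_le_ofReal (by positivity) (by simp)
    have key := prekopaLeindler_of_bounded (u := fun x => (min (u x) N).toReal)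
      (v := fun x => (min (v x) N).toReal) (w := fun x => (min (w x) N).toReal)
      (by fun_prop) (by fun_prop) (by fun_prop) (fun _ => ENNReal.toReal_nonneg)
      (fun _ => ENNReal.toReal_nonneg) (fun _ => ENNReal.toReal_nonneg) (fun x => le _)
      (fun x => le _) (fun x y => by
        rw [← ENNReal.toReal_mul, ← ENNReal.toReal_pow]
        refine ENNReal.toReal_mono (ENNReal.pow_ne_top
          (ne_top_of_le_ne_top (ENNReal.natCast_ne_top N) (min_le_right _ _))) ?_
        rcases le_total (w ((x + y) / 2)) N with h1 | h1
        · rw [min_eq_left h1]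
          exact (mul_le_mul' (min_le_left _ _) (min_le_left _ _)).trans (h x y)
        · rw [min_eq_right h1, sq]
          exact mul_le_mul' (min_le_right _ _) (min_le_right _ _))
    simp_rw [tr] at key
    refine key.trans ?_
    gcongr with x
    exact min_le_left _ _
  -- Vanishing integrals are set aside because multiplication on `ℝ≥0∞` is discontinuous at `(0,
  -- ∞)`.
  by_cases hu0 : ∫⁻ x, u x = 0
  · simp [hu0]
  by_cases hv0 : ∫⁻ x, v x = 0
  · simp [hv0]
  exact le_of_tendsto' (ENNReal.Tendsto.mul (sup u hu) (Or.inl hu0) (sup v hv) (Or.inl hv0)) bdd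

/-! ### Curvature: the strengthened inequality, its tensorization and a Gaussian moment -/

theorem strongConcaveOn_add_le_midpoint {U : ℝ → ℝ} {m : ℝ} (hU : StrongConcaveOn Set.univ m U)
    (x y : ℝ) : U x + U y ≤ 2 * U ((x + y) / 2) - m / 4 * (x - y) ^ 2 := by
  obtain ⟨_, h⟩ := hU
  have := h (Set.mem_univ x) (Set.mem_univ y) (a := 1 / 2) (b := 1 / 2) (by norm_num)
    (by norm_num) (by norm_num)
  simp only [smul_eq_mul, Real.norm_eq_abs, sq_abs] at this
  rw [show 1 / 2 * x + 1 / 2 * y = (x + y) / 2 by ring] at this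
  linarith

/-- The strengthened Prékopa–Leindler inequality, with curvature `c`, relative to a measure `ν` on
`ℝᵖ`, for midpoints. -/
def HasCurvedPL {p : ℕ} (c : ℝ) (ν : Measure (Fin p → ℝ)) : Prop :=
  ∀ u v w : (Fin p → ℝ) → ℝ≥0∞, Measurable u → Measurable v → Measurable w →
    (∀ x y, u x * v y ≤ w (fun j => (x j + y j) / 2) ^ 2 *
      ENNReal.ofReal (Real.exp (c * ∑ j, (x j - y j) ^ 2))) →
    (∫⁻ x, u x ∂ν) * ∫⁻ x, v x ∂ν ≤ (∫⁻ x, w x ∂ν) ^ 2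

/-- Multiplying the functions by the density `exp U` reduces to Lebesgue measure: strong concavity
at the midpoint gains `exp (-m / 4 * (x - y) ^ 2)`, exactly the loss that the hypothesis allows. -/
theorem curved_prekopaLeindler {U : ℝ → ℝ} (hUc : Continuous U) {m : ℝ}
    (hU : StrongConcaveOn Set.univ m U) {u v w : ℝ → ℝ≥0∞} (hu : Measurable u) (hv : Measurable v)
    (hw : Measurable w)
    (h : ∀ x y, u x * v y ≤ w ((x + y) / 2) ^ 2 *
      ENNReal.ofReal (Real.exp (m / 4 * (x - y) ^ 2))) {μ : Measure ℝ}
    (hμ : μ = (volume : Measure ℝ).withDensity (fun x => ENNReal.ofReal (Real.exp (U x)))) :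
    (∫⁻ x, u x ∂μ) * ∫⁻ x, v x ∂μ ≤ (∫⁻ x, w x ∂μ) ^ 2 := by
  have hd : Measurable fun x => ENNReal.ofReal (Real.exp (U x)) := by fun_prop
  rw [hμ, lintegral_withDensity_eq_lintegral_mul _ hd hu,
    lintegral_withDensity_eq_lintegral_mul _ hd hv, lintegral_withDensity_eq_lintegral_mul _ hd hw]
  refine prekopaLeindler (hd.mul hu) (hd.mul hv) (hd.mul hw) fun x y => ?_
  simp only [Pi.mul_apply]
  calc ENNReal.ofReal (Real.exp (U x)) * u x * (ENNReal.ofReal (Real.exp (U y)) * v y)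
      = ENNReal.ofReal (Real.exp (U x + U y)) * (u x * v y) := by
        rw [Real.exp_add, ENNReal.ofReal_mul (Real.exp_pos _).le]; ring
    _ ≤ ENNReal.ofReal (Real.exp (2 * U ((x + y) / 2) - m / 4 * (x - y) ^ 2)) *
        (w ((x + y) / 2) ^ 2 * ENNReal.ofReal (Real.exp (m / 4 * (x - y) ^ 2))) := by
        refine mul_le_mul' (ENNReal.ofReal_le_ofReal (Real.exp_le_exp.mpr ?_)) ?_
        · exact strongConcaveOn_add_le_midpoint hU x y
        · exact h x y
    _ = ENNReal.ofReal (Real.exp (2 * U ((x + y) / 2) - m / 4 * (x - y) ^ 2)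
          * Real.exp (m / 4 * (x - y) ^ 2)) * w ((x + y) / 2) ^ 2 := by
        rw [ENNReal.ofReal_mul (Real.exp_pos _).le]; ring
    _ = (ENNReal.ofReal (Real.exp (U ((x + y) / 2))) * w ((x + y) / 2)) ^ 2 := by
        rw [← Real.exp_add, mul_pow, ← ENNReal.ofReal_pow (Real.exp_pos _).le, ← Real.exp_nat_mul]
        congr 3
        push_cast
        ring

theorem lintegral_pi_succ {p : ℕ} (μ : Measure ℝ) [SigmaFinite μ] {f : (Fin (p + 1) → ℝ) → ℝ≥0∞}
    (hf : Measurable f) :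
    ∫⁻ x, f x ∂(Measure.pi fun _ => μ) =
      ∫⁻ s, ∫⁻ x, f (Fin.cons s x) ∂(Measure.pi fun _ : Fin p => μ) ∂μ := by
  have e := (measurePreserving_piFinSuccAbove (fun _ : Fin (p + 1) => μ) 0).symm
  rw [← e.lintegral_comp_emb (MeasurableEquiv.measurableEmbedding _), lintegral_prod]
  · simp [MeasurableEquiv.piFinSuccAbove, Fin.insertNthEquiv, Fin.insertNth_zero']
  · exact (hf.comp (MeasurableEquiv.measurable _)).aemeasurable

/-- Induction on the dimension by Fubini: the inequality for the remaining coordinates shows that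
the partial integrals satisfy the one-dimensional hypothesis in the first coordinate. The quadratic
cost is additive, so the constant `c` does not deteriorate. -/
theorem hasCurvedPL_pi {μ : Measure ℝ} [SigmaFinite μ] {c : ℝ}
    (h1 : ∀ u v w : ℝ → ℝ≥0∞, Measurable u → Measurable v → Measurable w →
      (∀ x y, u x * v y ≤ w ((x + y) / 2) ^ 2 * ENNReal.ofReal (Real.exp (c * (x - y) ^ 2))) →
      (∫⁻ x, u x ∂μ) * ∫⁻ x, v x ∂μ ≤ (∫⁻ x, w x ∂μ) ^ 2) (p : ℕ) :
    HasCurvedPL c (Measure.pi fun _ : Fin p => μ) := by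
  induction p with
  | zero =>
    intro u v w hu hv hw h
    rw [Measure.pi_of_empty (fun _ : Fin 0 => μ) Fin.elim0, lintegral_dirac, lintegral_dirac,
      lintegral_dirac]
    refine (h _ _).trans (le_of_eq ?_)
    simp [Subsingleton.elim (fun j : Fin 0 => _) (Fin.elim0 : Fin 0 → ℝ)]
  | succ p ih =>
    intro u v w hu hv hw h
    have hcons : Measurable fun z : ℝ × (Fin p → ℝ) => (Fin.cons z.1 z.2 : Fin (p + 1) → ℝ) := by
      refine measurable_pi_lambda _ fun j => ?_
      refine Fin.cases ?_ (fun i => ?_) j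
      · simpa using measurable_fst
      · simp only [Fin.cons_succ]
        fun_prop
    have hc1 : ∀ s : ℝ, Measurable fun z : Fin p → ℝ => (Fin.cons s z : Fin (p + 1) → ℝ) :=
      fun s => hcons.comp measurable_prodMk_left
    rw [lintegral_pi_succ μ hu, lintegral_pi_succ μ hv, lintegral_pi_succ μ hw]
    have hmeas : ∀ f : (Fin (p + 1) → ℝ) → ℝ≥0∞, Measurable f →
        Measurable fun s : ℝ => ∫⁻ x, f (Fin.cons s x) ∂(Measure.pi fun _ : Fin p => μ) :=
      fun f hf => (hf.comp hcons).lintegral_prod_right'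
    refine h1 _ _ _ (hmeas u hu) (hmeas v hv) (hmeas w hw) fun s t => ?_
    -- The exponent is halved because `w` enters squared: `w * E` carries the whole cost of the
    -- first coordinate.
    set E := ENNReal.ofReal (Real.exp (c / 2 * (s - t) ^ 2)) with hE
    have hE2 : E ^ 2 = ENNReal.ofReal (Real.exp (c * (s - t) ^ 2)) := by
      rw [hE, ← ENNReal.ofReal_pow (Real.exp_pos _).le, ← Real.exp_nat_mul]
      congr 2
      push_cast
      ring
    rw [← hE2, ← mul_pow, ← lintegral_mul_const' _ _ ENNReal.ofReal_ne_top]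
    refine ih _ _ _ (hu.comp (hc1 s)) (hv.comp (hc1 t))
      ((hw.comp (hc1 ((s + t) / 2))).mul_const _) fun x y => ?_
    refine (h (Fin.cons s x) (Fin.cons t y)).trans (le_of_eq ?_)
    have e1 : (fun j => ((Fin.cons s x : Fin (p + 1) → ℝ) j + (Fin.cons t y : Fin (p + 1) → ℝ) j) / 2)
        = Fin.cons ((s + t) / 2) fun j => (x j + y j) / 2 := by
      funext j
      refine Fin.cases ?_ (fun i => ?_) j <;> simp
    rw [e1, Fin.sum_univ_succ, mul_pow, hE2]
    simp only [Fin.cons_zero, Fin.cons_succ, mul_add, Real.exp_add]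
    rw [ENNReal.ofReal_mul (Real.exp_pos _).le]
    ring

/-- A strongly log-concave measure on the line has a Gaussian moment. -/
theorem lintegral_exp_sq_lt_top {U : ℝ → ℝ} (hUc : Continuous U) {m : ℝ} (hm : 0 < m)
    (hU : StrongConcaveOn Set.univ m U) {μ : Measure ℝ} [IsProbabilityMeasure μ]
    (hμ : μ = (volume : Measure ℝ).withDensity (fun x => ENNReal.ofReal (Real.exp (U x)))) :
    ∫⁻ x, ENNReal.ofReal (Real.exp (m / 8 * x ^ 2)) ∂μ < ⊤ := by
  set I : Set ℝ := Set.Icc (-1) 1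
  have hI : MeasurableSet I := measurableSet_Icc
  -- Testing against the indicator of `[-1, 1]`: for `|y| ≤ 1` one has `x² ≤ 2 (x - y)² + 2`, so a
  -- constant `w` is admissible. Finiteness follows since `[-1, 1]` has positive mass.
  have key := curved_prekopaLeindler hUc hU
    (u := fun x => ENNReal.ofReal (Real.exp (m / 8 * x ^ 2))) (v := I.indicator 1)
    (w := fun _ => ENNReal.ofReal (Real.exp (m / 8))) (by fun_prop) (measurable_one.indicator hI)
    measurable_const (fun x y => by
      by_cases hy : y ∈ I
      · rw [Set.indicator_of_mem hy, Pi.one_apply, mul_one, ← ENNReal.ofReal_pow (Real.exp_pos _).le,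
          ← ENNReal.ofReal_mul (by positivity), ← Real.exp_nat_mul, ← Real.exp_add]
        refine ENNReal.ofReal_le_ofReal (Real.exp_le_exp.mpr ?_)
        have h1 : y ^ 2 ≤ 1 := by
          have := hy.1; have := hy.2; nlinarith
        have h2 : x ^ 2 ≤ 2 * (x - y) ^ 2 + 2 := by nlinarith [sq_nonneg (x - 2 * y)]
        push_cast
        nlinarith
      · simp [Set.indicator_of_notMem hy]) hμ
  rw [lintegral_indicator hI, lintegral_const] at key
  simp only [measure_univ, mul_one, Pi.one_apply, lintegral_one, Measure.restrict_apply_univ] at key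
  have hpos : μ I ≠ 0 := by
    intro h0
    rw [hμ, withDensity_apply_eq_zero' (by fun_prop)] at h0
    have : {x | ENNReal.ofReal (Real.exp (U x)) ≠ 0} ∩ I = I := by
      ext x; simp [Real.exp_pos]
    rw [this] at h0
    norm_num [I] at h0
  by_contra hcon
  rw [not_lt, top_le_iff] at hcon
  rw [hcon, ENNReal.top_mul hpos, top_le_iff] at key
  exact ENNReal.pow_ne_top ENNReal.ofReal_ne_top key

/-! ### Optimal transport on the line -/

theorem cdf_strictMono {P : Measure ℝ} [IsProbabilityMeasure P] [P.IsOpenPosMeasure] :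
    StrictMono (cdf P) := by
  intro x y hxy
  rw [cdf_eq_real, cdf_eq_real, ← Set.Iic_union_Ioc_eq_Iic hxy.le,
    measureReal_union (by
      rw [Set.disjoint_left]; intro a ha hb; exact absurd hb.1 (not_lt.mpr ha)) measurableSet_Ioc]
  have : 0 < P (Set.Ioc x y) :=
    (isOpen_Ioo.measure_pos P (Set.nonempty_Ioo.mpr hxy)).trans_le
      (measure_mono Set.Ioo_subset_Ioc_self)
  have := ENNReal.toReal_pos this.ne' (measure_ne_top _ _)
  simpa [measureReal_def] using this

theorem cdf_continuous {P : Measure ℝ} [IsProbabilityMeasure P] [NullSingletonClass P] :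
    Continuous (cdf P) := by
  refine continuous_iff_continuousAt.mpr fun x => ?_
  rw [(monotone_cdf P).continuousAt_iff_leftLim_eq_rightLim, StieltjesFunction.rightLim_eq]
  have h := (cdf P).measure_singleton x
  rw [measure_cdf, measure_singleton, eq_comm, ENNReal.ofReal_eq_zero, sub_nonpos] at h
  exact le_antisymm ((monotone_cdf P).leftLim_le le_rfl) h

theorem cdf_mem_Ioo {P : Measure ℝ} [IsProbabilityMeasure P] [P.IsOpenPosMeasure] (x : ℝ) :
    cdf P x ∈ Set.Ioo (0 : ℝ) 1 :=
  ⟨(cdf_nonneg P (x - 1)).trans_lt (cdf_strictMono (sub_one_lt x)),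
    (cdf_strictMono (lt_add_one x)).trans_le (cdf_le_one P (x + 1))⟩

/-- The distribution function of a diffuse measure with full support, as an order isomorphism. -/
def cdfIso (P : Measure ℝ) [IsProbabilityMeasure P] [P.IsOpenPosMeasure] [NullSingletonClass P] :
    ℝ ≃o Set.Ioo (0 : ℝ) 1 :=
  StrictMono.orderIsoOfSurjective (fun x => ⟨cdf P x, cdf_mem_Ioo x⟩)
    (fun _ _ h => cdf_strictMono h) (fun r => by
      obtain ⟨a, ha⟩ := ((tendsto_cdf_atBot P).eventually_lt_const r.2.1).exists
      obtain ⟨b, hb⟩ := ((tendsto_cdf_atTop P).eventually_const_lt r.2.2).exists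
      obtain ⟨x, hx⟩ := mem_range_of_exists_le_of_exists_ge (cdf_continuous (P := P)) ⟨a, ha.le⟩
        ⟨b, hb.le⟩
      exact ⟨x, Subtype.ext hx⟩)

/-- The monotone rearrangement of `P` into `Q`. -/
theorem exists_orderIso_map_eq (P Q : Measure ℝ) [IsProbabilityMeasure P] [P.IsOpenPosMeasure]
    [NullSingletonClass P] [IsProbabilityMeasure Q] [Q.IsOpenPosMeasure] [NullSingletonClass Q] :
    ∃ T : ℝ ≃o ℝ, P.map T = Q := by
  refine ⟨(cdfIso P).trans (cdfIso Q).symm, ?_⟩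
  set T := (cdfIso P).trans (cdfIso Q).symm
  have hT : Measurable T := T.monotone.measurable
  have := Measure.isProbabilityMeasure_map (μ := P) hT.aemeasurable
  refine Measure.ext_of_Iic _ _ fun y => ?_
  rw [Measure.map_apply hT measurableSet_Iic]
  have h1 : T ⁻¹' Set.Iic y = Set.Iic (T.symm y) := by
    ext x; simp [T.le_symm_apply]
  rw [h1, ← ofReal_cdf, ← ofReal_cdf]
  have h2 : cdfIso P (T.symm y) = cdfIso Q y := by simp [T]
  exact congrArg ENNReal.ofReal (congrArg Subtype.val h2)

theorem wasserstein2_sq_le {P Q : Measure ℝ} {T : ℝ → ℝ} (hT : Measurable T) (h : P.map T = Q) :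
    wasserstein2 P Q ^ 2 ≤ ∫⁻ x, ENNReal.ofReal ((x - T x) ^ 2) ∂P := by
  have hm : Measurable fun x => (x, T x) := measurable_id.prodMk hT
  have hγ : P.map (fun x => (x, T x)) ∈ {γ : Measure (ℝ × ℝ) | γ.fst = P ∧ γ.snd = Q} := by
    constructor
    · rw [Measure.fst_map_prodMk hT, Measure.map_id']
    · exact (Measure.snd_map_prodMk (X := fun x : ℝ => x) (Y := T) measurable_id).trans h
  calc wasserstein2 P Q ^ 2
      ≤ ((∫⁻ z, edist z.1 z.2 ^ 2 ∂(P.map fun x => (x, T x))) ^ (1 / 2 : ℝ)) ^ 2 := by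
        gcongr
        exact iInf₂_le _ hγ
    _ = ∫⁻ z, edist z.1 z.2 ^ 2 ∂(P.map fun x => (x, T x)) := by
        rw [← ENNReal.rpow_natCast, ← ENNReal.rpow_mul]; norm_num
    _ = ∫⁻ x, ENNReal.ofReal ((x - T x) ^ 2) ∂P := by
        rw [lintegral_map (by fun_prop) hm]
        refine lintegral_congr fun x => ?_
        rw [edist_dist, ← ENNReal.ofReal_pow dist_nonneg, Real.dist_eq, sq_abs]

/-- Kantorovich duality on the line: the squared Wasserstein distance is bounded by the value of an
admissible pair of potentials. -/
theorem exists_kantorovich_potentials (P Q : Measure ℝ) [IsProbabilityMeasure P]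
    [P.IsOpenPosMeasure] [NullSingletonClass P] [IsProbabilityMeasure Q] [Q.IsOpenPosMeasure] [NullSingletonClass Q]
    (hP : Integrable (fun x => x ^ 2) P) (hQ : Integrable (fun x => x ^ 2) Q) :
    ∃ f g : ℝ → ℝ, Measurable f ∧ Measurable g ∧ (∀ x y, f x + g y ≤ (x - y) ^ 2) ∧
      Integrable f P ∧ Integrable g Q ∧ 0 ≤ ∫ x, f x ∂P + ∫ y, g y ∂Q ∧
      wasserstein2 P Q ^ 2 ≤ ENNReal.ofReal (∫ x, f x ∂P + ∫ y, g y ∂Q) := by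
  obtain ⟨T, hT⟩ := exists_orderIso_map_eq P Q
  have hTc : Continuous T := T.continuous
  have hTm : Measurable T := hTc.measurable
  -- The derivative of `f` at `x` is that of `(x - y) ^ 2` in `x` at the optimal `y = T x`. The
  -- potential `g` is then chosen so that equality holds on the graph of `T`.
  set f : ℝ → ℝ := fun x => ∫ s in (0 : ℝ)..x, 2 * (s - T s) with hf
  have hint : ∀ a b, IntervalIntegrable (fun s => 2 * (s - T s)) volume a b := fun a b =>
    (by fun_prop : Continuous fun s => 2 * (s - T s)).intervalIntegrable a b
  have hfc : Continuous f := intervalIntegral.continuous_primitive hint 0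
  set g : ℝ → ℝ := fun y => (T.symm y - y) ^ 2 - f (T.symm y) with hg
  have hTs : Continuous T.symm := T.symm.continuous
  have hgc : Continuous g := by fun_prop
  have hfT : ∀ x, f x + g (T x) = (x - T x) ^ 2 := fun x => by simp [hg]
  have hquad : ∀ c a b : ℝ, ∫ s in a..b, 2 * (s - c) = (b - c) ^ 2 - (a - c) ^ 2 := fun c a b => by
    rw [intervalIntegral.integral_const_mul, intervalIntegral.integral_sub (by simp) (by simp)]
    simp
    ring
  -- This is admissibility of the pair, and the only place where optimality of `T` enters:
  -- monotonicity compares the integrand with the one where `T` is frozen at `T x₀`.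
  have hdiff : ∀ x x₀, f x ≤ f x₀ + (x - T x₀) ^ 2 - (x₀ - T x₀) ^ 2 := fun x x₀ => by
    have e : f x - f x₀ = ∫ s in x₀..x, 2 * (s - T s) :=
      intervalIntegral.integral_interval_sub_left (hint _ _) (hint _ _)
    have hi2 : ∀ a b, IntervalIntegrable (fun s => 2 * (s - T x₀)) volume a b := fun a b =>
      (by fun_prop : Continuous fun s => 2 * (s - T x₀)).intervalIntegrable a b
    have : ∫ s in x₀..x, 2 * (s - T s) ≤ ∫ s in x₀..x, 2 * (s - T x₀) := by
      rcases le_total x₀ x with h | h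
      · refine intervalIntegral.integral_mono_on h (hint _ _) (hi2 _ _) fun s hs => ?_
        have := T.monotone hs.1
        linarith
      · rw [intervalIntegral.integral_symm x, intervalIntegral.integral_symm x]
        refine neg_le_neg (intervalIntegral.integral_mono_on h (hi2 _ _) (hint _ _) fun s hs => ?_)
        have := T.monotone hs.2
        linarith
    rw [hquad] at this
    linarith
  have hadm : ∀ x y, f x + g y ≤ (x - y) ^ 2 := fun x y => by
    have := hdiff x (T.symm y)
    simp only [OrderIso.apply_symm_apply] at this
    simp only [hg]
    linarith
  have hf0 : f 0 = 0 := by simp [hf]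
  have hfle : ∀ x, f x ≤ 2 * x ^ 2 + 2 * T 0 ^ 2 := fun x => by
    have := hdiff x 0
    nlinarith [sq_nonneg (x + T 0), sq_nonneg (T 0)]
  have hgle : ∀ y, g y ≤ y ^ 2 := fun y => by
    have := hadm 0 y
    nlinarith
  have hQ' : Integrable (fun x => T x ^ 2) P := by
    rw [← hT, integrable_map_measure (by fun_prop) hTm.aemeasurable] at hQ
    exact hQ
  -- Admissibility bounds `f` and `g` above by quadratics. As `f x + g (T x) ≥ 0`, each upper bound
  -- gives a lower bound for the other function.
  have hdom : Integrable (fun x => 2 * x ^ 2 + 2 * T 0 ^ 2 + T x ^ 2) P :=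
    ((hP.const_mul 2).add (integrable_const _)).add hQ'
  have hfi : Integrable f P := hdom.mono' hfc.aestronglyMeasurable <| ae_of_all _ fun x => by
    rw [Real.norm_eq_abs, abs_le]
    constructor
    · nlinarith [hfT x, hgle (T x), sq_nonneg (x - T x), sq_nonneg x, sq_nonneg (T 0)]
    · nlinarith [hfle x, sq_nonneg (T x)]
  have hgT : Integrable (fun x => g (T x)) P :=
    hdom.mono' (hgc.comp hTc).aestronglyMeasurable <| ae_of_all _ fun x => by
      rw [Real.norm_eq_abs, abs_le]
      constructor
      · nlinarith [hfT x, hfle x, sq_nonneg (x - T x), sq_nonneg (T x)]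
      · nlinarith [hgle (T x), sq_nonneg x, sq_nonneg (T 0)]
  have e : ∫ x, f x ∂P + ∫ y, g y ∂Q = ∫ x, (x - T x) ^ 2 ∂P := by
    have e' : ∫ y, g y ∂Q = ∫ x, g (T x) ∂P := by
      rw [← hT, integral_map hTm.aemeasurable (by fun_prop)]
    rw [e', ← integral_add hfi hgT, integral_congr_ae (ae_of_all _ hfT)]
  refine ⟨f, g, hfc.measurable, hgc.measurable, hadm, hfi, ?_, ?_, ?_⟩
  · rw [← hT, integrable_map_measure (by fun_prop) hTm.aemeasurable]
    exact hgT
  · rw [e]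
    exact integral_nonneg fun x => sq_nonneg _
  · rw [e, ofReal_integral_eq_lintegral_ofReal _ (ae_of_all _ fun x => sq_nonneg _)]
    · exact wasserstein2_sq_le hTm hT
    · exact (hfi.add hgT).congr (ae_of_all _ hfT)

/-! ### Stability of strongly log-concave measures under linear tilts -/

/-- Jensen's inequality, in a form that needs no exponential integrability: an infinite right-hand
side is harmless. -/
theorem ofReal_exp_integral_le {E : Type*} [MeasurableSpace E] {P : Measure E}
    [IsProbabilityMeasure P] {Φ : E → ℝ} (hΦ : Integrable Φ P) :
    ENNReal.ofReal (Real.exp (∫ x, Φ x ∂P)) ≤ ∫⁻ x, ENNReal.ofReal (Real.exp (Φ x)) ∂P := by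
  by_cases h : ∫⁻ x, ENNReal.ofReal (Real.exp (Φ x)) ∂P = ⊤
  · simp [h]
  have hm : AEStronglyMeasurable (fun x => Real.exp (Φ x)) P :=
    Real.continuous_exp.comp_aestronglyMeasurable hΦ.1
  have hi : Integrable (fun x => Real.exp (Φ x)) P := by
    refine ⟨hm, ?_⟩
    rw [hasFiniteIntegral_iff_ofReal (ae_of_all _ fun x => (Real.exp_pos _).le)]
    exact lt_top_iff_ne_top.mpr h
  rw [← ofReal_integral_eq_lintegral_ofReal hi (ae_of_all _ fun x => (Real.exp_pos _).le)]
  refine ENNReal.ofReal_le_ofReal ?_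
  exact convexOn_exp.map_integral_le Real.continuous_exp.continuousOn isClosed_univ
    (ae_of_all _ fun _ => Set.mem_univ _) hΦ hi

theorem sq_lintegral_exp_half_le {E : Type*} [MeasurableSpace E] {ν : Measure E} {a b : E → ℝ}
    (ha : Measurable a) (hb : Measurable b) :
    (∫⁻ x, ENNReal.ofReal (Real.exp ((a x + b x) / 2)) ∂ν) ^ 2 ≤
      (∫⁻ x, ENNReal.ofReal (Real.exp (a x)) ∂ν) * ∫⁻ x, ENNReal.ofReal (Real.exp (b x)) ∂ν := by
  have key := ENNReal.lintegral_mul_le_Lp_mul_Lq ν Real.HolderConjugate.two_two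
    (f := fun x => ENNReal.ofReal (Real.exp (a x / 2)))
    (g := fun x => ENNReal.ofReal (Real.exp (b x / 2))) (by fun_prop) (by fun_prop)
  have hsq : ∀ t : ℝ, ENNReal.ofReal (Real.exp (t / 2)) ^ (2 : ℝ) = ENNReal.ofReal (Real.exp t) := by
    intro t
    rw [ENNReal.ofReal_rpow_of_pos (Real.exp_pos _), ← Real.exp_mul]
    congr 2
    ring
  simp only [Pi.mul_apply, hsq, ← ENNReal.ofReal_mul (Real.exp_pos _).le, ← Real.exp_add,
    ← add_div] at key
  refine (pow_le_pow_left₀ (by positivity) key 2).trans (le_of_eq ?_)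
  have hr : ∀ z : ℝ≥0∞, (z ^ (1 / 2 : ℝ)) ^ 2 = z := fun z => by
    rw [← ENNReal.rpow_natCast, ← ENNReal.rpow_mul]; norm_num
  rw [mul_pow, hr, hr]

theorem lintegral_exp_add_eq {E : Type*} [MeasurableSpace E] {ν : Measure E} {a φ : E → ℝ}
    (ha : Integrable (fun x => Real.exp (a x)) ν) [NeZero ν] :
    ∫⁻ x, ENNReal.ofReal (Real.exp (φ x + a x)) ∂ν =
      ENNReal.ofReal (∫ x, Real.exp (a x) ∂ν) *
        ∫⁻ x, ENNReal.ofReal (Real.exp (φ x)) ∂(ν.tilted a) := by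
  rw [lintegral_tilted, ← lintegral_const_mul' _ _ ENNReal.ofReal_ne_top]
  have hZ : 0 < ∫ x, Real.exp (a x) ∂ν := integral_exp_pos ha
  refine lintegral_congr fun x => ?_
  rw [← mul_assoc, ← ENNReal.ofReal_mul hZ.le, mul_div_cancel₀ _ hZ.ne', Real.exp_add, mul_comm,
    ENNReal.ofReal_mul (Real.exp_pos _).le]

/-- Curved Prékopa–Leindler is applied to the two densities multiplied by `exp Φ` and `exp Ψ`, the
exponentials of the scaled separable potentials. Jensen bounds the left side below, Cauchy–Schwarz
bounds the right side above, and both produce the product of the normalizing constants, which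
cancels. -/
theorem sum_integral_potentials_le {p : ℕ} {m : ℝ} (hm : 0 < m) {ν : Measure (Fin p → ℝ)}
    [IsProbabilityMeasure ν] (hν : HasCurvedPL (m / 4) ν) {a b : (Fin p → ℝ) → ℝ} {h : Fin p → ℝ}
    (ham : Measurable a) (hbm : Measurable b)
    (ha : Integrable (fun x => Real.exp (a x)) ν) (hb : Integrable (fun x => Real.exp (b x)) ν)
    (hab : ∀ x, b x = a x + ∑ j, h j * x j)
    (hconc : ∀ x y, a x + a y ≤ 2 * a fun j => (x j + y j) / 2)
    {f g : Fin p → ℝ → ℝ} (hf : ∀ j, Measurable (f j)) (hg : ∀ j, Measurable (g j))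
    (hfg : ∀ j x y, f j x + g j y ≤ (x - y) ^ 2)
    (hfi : ∀ j, Integrable (f j) (marginal (ν.tilted a) j))
    (hgi : ∀ j, Integrable (g j) (marginal (ν.tilted b) j)) :
    ∑ j, (∫ x, f j x ∂(marginal (ν.tilted a) j) + ∫ x, g j x ∂(marginal (ν.tilted b) j)) ≤
      4 / m ^ 2 * ∑ j, h j ^ 2 := by
  have hPa := isProbabilityMeasure_tilted ha
  have hPb := isProbabilityMeasure_tilted hb
  set Φ : (Fin p → ℝ) → ℝ := fun x => m / 8 * ∑ j, f j (x j) with hΦ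
  set Ψ : (Fin p → ℝ) → ℝ := fun x => m / 8 * ∑ j, g j (x j) with hΨ
  have hΦm : Measurable Φ := (Finset.measurable_sum _ fun j _ =>
    (hf j).comp (measurable_pi_apply j)).const_mul _
  have hΨm : Measurable Ψ := (Finset.measurable_sum _ fun j _ =>
    (hg j).comp (measurable_pi_apply j)).const_mul _
  have hfi' : ∀ j, Integrable (fun x : Fin p → ℝ => f j (x j)) (ν.tilted a) := fun j =>
    (hfi j).comp_measurable (measurable_pi_apply j)
  have hgi' : ∀ j, Integrable (fun x : Fin p → ℝ => g j (x j)) (ν.tilted b) := fun j =>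
    (hgi j).comp_measurable (measurable_pi_apply j)
  have hΦi : Integrable Φ (ν.tilted a) := (integrable_finsetSum _ fun j _ => hfi' j).const_mul _
  have hΨi : Integrable Ψ (ν.tilted b) := (integrable_finsetSum _ fun j _ => hgi' j).const_mul _
  have hΦe : ∫ x, Φ x ∂(ν.tilted a) = m / 8 * ∑ j, ∫ x, f j x ∂(marginal (ν.tilted a) j) := by
    rw [hΦ, integral_const_mul, integral_finsetSum _ fun j _ => hfi' j]
    congr 1
    refine Finset.sum_congr rfl fun j _ => ?_
    rw [marginal, integral_map (measurable_pi_apply j).aemeasurable (hf j).aestronglyMeasurable]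
  have hΨe : ∫ x, Ψ x ∂(ν.tilted b) = m / 8 * ∑ j, ∫ x, g j x ∂(marginal (ν.tilted b) j) := by
    rw [hΨ, integral_const_mul, integral_finsetSum _ fun j _ => hgi' j]
    congr 1
    refine Finset.sum_congr rfl fun j _ => ?_
    rw [marginal, integral_map (measurable_pi_apply j).aemeasurable (hg j).aestronglyMeasurable]
  set H := ∑ j, h j ^ 2 with hH
  -- With this `w`, the tilt leaves the error `-h j * (x j - y j) / 2` in each coordinate. The
  -- potentials use `m / 8` of the available curvature `m / 4`; the remaining `m / 8` absorbs this
  -- error at the price `h j ^ 2 / (2 * m)`, whence the factor `exp (H / (4 * m))` in `w`.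
  have key := hν (fun x => ENNReal.ofReal (Real.exp (Φ x + a x)))
    (fun x => ENNReal.ofReal (Real.exp (Ψ x + b x)))
    (fun x => ENNReal.ofReal (Real.exp (H / (4 * m))) * ENNReal.ofReal (Real.exp ((a x + b x) / 2)))
    (by fun_prop) (by fun_prop) (by fun_prop) (fun x y => by
      rw [← ENNReal.ofReal_mul (Real.exp_pos _).le, ← ENNReal.ofReal_mul (Real.exp_pos _).le,
        ← ENNReal.ofReal_pow (by positivity), ← ENNReal.ofReal_mul (by positivity), ← Real.exp_add,
        ← Real.exp_add, ← Real.exp_nat_mul, ← Real.exp_add]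
      refine ENNReal.ofReal_le_ofReal (Real.exp_le_exp.mpr ?_)
      have h1 : Φ x + Ψ y + ∑ j, h j * y j ≤ H / (2 * m) + ∑ j, h j * ((x j + y j) / 2)
          + m / 4 * ∑ j, (x j - y j) ^ 2 := by
        simp only [hΦ, hΨ, hH, Finset.mul_sum, Finset.sum_div, ← Finset.sum_add_distrib]
        refine Finset.sum_le_sum fun j _ => ?_
        have e1 : m / 8 * (f j (x j) + g j (y j)) ≤ m / 8 * (x j - y j) ^ 2 :=
          mul_le_mul_of_nonneg_left (hfg j _ _) (by positivity)
        have e2 : 0 ≤ m / 8 * ((x j - y j) + 2 * h j / m) ^ 2 := by positivity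
        have e3 : m / 8 * ((x j - y j) + 2 * h j / m) ^ 2 = m / 8 * (x j - y j) ^ 2
          + h j * (x j - y j) / 2 + h j ^ 2 / (2 * m) := by field_simp; ring
        linarith
      have h2 := hconc x y
      rw [hab y, hab]
      push_cast
      have h3 : H / (2 * m) = 2 * (H / (4 * m)) := by field_simp; ring
      linarith)
  rw [lintegral_exp_add_eq ha, lintegral_exp_add_eq hb, lintegral_const_mul' _ _
    ENNReal.ofReal_ne_top, mul_pow] at key
  set Za := ∫ x, Real.exp (a x) ∂ν with hZa
  set Zb := ∫ x, Real.exp (b x) ∂ν with hZb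
  have hZa0 : 0 < Za := integral_exp_pos ha
  have hZb0 : 0 < Zb := integral_exp_pos hb
  have hCS := sq_lintegral_exp_half_le (ν := ν) ham hbm
  rw [← ofReal_integral_eq_lintegral_ofReal ha (ae_of_all _ fun x => (Real.exp_pos _).le),
    ← ofReal_integral_eq_lintegral_ofReal hb (ae_of_all _ fun x => (Real.exp_pos _).le), ← hZa,
    ← hZb] at hCS
  have J1 := ofReal_exp_integral_le hΦi
  have J2 := ofReal_exp_integral_le hΨi
  have fin : ENNReal.ofReal Za * ENNReal.ofReal (Real.exp (∫ x, Φ x ∂(ν.tilted a))) *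
      (ENNReal.ofReal Zb * ENNReal.ofReal (Real.exp (∫ x, Ψ x ∂(ν.tilted b)))) ≤
      ENNReal.ofReal (Real.exp (H / (4 * m))) ^ 2 * (ENNReal.ofReal Za * ENNReal.ofReal Zb) :=
    (by gcongr : _ ≤ _).trans (key.trans (by gcongr))
  rw [← ENNReal.ofReal_mul hZa0.le, ← ENNReal.ofReal_mul hZb0.le, ← ENNReal.ofReal_mul hZa0.le,
    ← ENNReal.ofReal_mul (by positivity), ← ENNReal.ofReal_pow (Real.exp_pos _).le,
    ← ENNReal.ofReal_mul (by positivity), ENNReal.ofReal_le_ofReal_iff (by positivity)] at fin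
  have fin2 : Za * Zb * Real.exp (∫ x, Φ x ∂(ν.tilted a) + ∫ x, Ψ x ∂(ν.tilted b)) ≤
      Za * Zb * Real.exp (H / (2 * m)) := by
    rw [← Real.exp_nat_mul] at fin
    rw [show H / (2 * m) = ((2 : ℕ) : ℝ) * (H / (4 * m)) by push_cast; field_simp; ring, Real.exp_add]
    linarith
  have fin3 := Real.exp_le_exp.mp (le_of_mul_le_mul_left fin2 (mul_pos hZa0 hZb0))
  rw [hΦe, hΨe, ← mul_add, ← Finset.sum_add_distrib] at fin3
  have : 4 / m ^ 2 * H = 8 / m * (H / (2 * m)) := by field_simp; ring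
  rw [this]
  calc _ = 8 / m * (m / 8 * ∑ j, (∫ x, f j x ∂(marginal (ν.tilted a) j)
        + ∫ x, g j x ∂(marginal (ν.tilted b) j))) := by field_simp
    _ ≤ _ := by gcongr

/-! ### Application to the logistic posterior -/

theorem two_mul_log_one_add_exp_le (s t : ℝ) :
    2 * Real.log (1 + Real.exp ((s + t) / 2)) ≤
      Real.log (1 + Real.exp s) + Real.log (1 + Real.exp t) := by
  have hs := Real.exp_pos s
  have ht := Real.exp_pos t
  rw [← Real.log_mul (by positivity) (by positivity)]
  have : 2 * Real.log (1 + Real.exp ((s + t) / 2)) = Real.log ((1 + Real.exp ((s + t) / 2)) ^ 2) := by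
    rw [Real.log_pow]; norm_num
  rw [this]
  refine Real.log_le_log (by positivity) ?_
  have e1 : Real.exp s = Real.exp (s / 2) ^ 2 := by rw [← Real.exp_nat_mul]; congr 1; push_cast; ring
  have e2 : Real.exp t = Real.exp (t / 2) ^ 2 := by rw [← Real.exp_nat_mul]; congr 1; push_cast; ring
  rw [add_div, Real.exp_add, e1, e2]
  nlinarith [sq_nonneg (Real.exp (s / 2) - Real.exp (t / 2))]

theorem linPred_midpoint {n p : ℕ} (X : Fin n → Fin p → ℝ) (x y : Fin p → ℝ) (i : Fin n) :
    linPred X (fun j => (x j + y j) / 2) i = (linPred X x i + linPred X y i) / 2 := by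
  simp only [linPred, ← Finset.sum_add_distrib, Finset.sum_div]
  exact Finset.sum_congr rfl fun j _ => by ring

theorem logLik_midpoint {n p : ℕ} (X : Fin n → Fin p → ℝ) (y : Fin n → ℝ) (a b : Fin p → ℝ) :
    logLik X y a + logLik X y b ≤ 2 * logLik X y fun j => (a j + b j) / 2 := by
  simp only [logLik, ← Finset.sum_add_distrib, Finset.mul_sum, linPred_midpoint]
  refine Finset.sum_le_sum fun i _ => ?_
  have := two_mul_log_one_add_exp_le (linPred X a i) (linPred X b i)
  linarith

/-- The responses enter the log-likelihood linearly, so changing them is a linear tilt of the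
posterior. -/
theorem logLik_sub {n p : ℕ} (X : Fin n → Fin p → ℝ) (y y' : Fin n → ℝ) (b : Fin p → ℝ) :
    logLik X y' b = logLik X y b + ∑ j, (∑ i, (y' i - y i) * X i j) * b j := by
  simp only [logLik, Finset.sum_mul]
  rw [Finset.sum_comm, ← Finset.sum_add_distrib]
  refine Finset.sum_congr rfl fun i _ => ?_
  simp only [mul_assoc, ← Finset.mul_sum]
  rw [← linPred]
  ring

theorem measurable_logLik {n p : ℕ} (X : Fin n → Fin p → ℝ) (y : Fin n → ℝ) :
    Measurable (logLik X y) := by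
  unfold logLik linPred
  fun_prop

theorem integrable_exp_logLik {n p : ℕ} (ν : Measure (Fin p → ℝ)) [IsProbabilityMeasure ν]
    (X : Fin n → Fin p → ℝ) {y : Fin n → ℝ} (hy : ∀ i, y i ∈ Set.Icc (0 : ℝ) 1) :
    Integrable (fun b => Real.exp (logLik X y b)) ν := by
  refine Integrable.of_bound (C := 1)
    ((measurable_logLik X y).exp).aestronglyMeasurable (ae_of_all _ fun b => ?_)
  rw [Real.norm_eq_abs, Real.abs_exp]
  exact Real.exp_le_one_iff.mpr (logLik_nonpos X y hy b)

theorem marginal_absolutelyContinuous {p : ℕ} {μ : Measure ℝ} [IsProbabilityMeasure μ]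
    {P : Measure (Fin p → ℝ)} (h : P ≪ Measure.pi fun _ => μ) (j : Fin p) : marginal P j ≪ μ := by
  have := h.map (measurable_pi_apply j)
  rwa [(measurePreserving_eval (fun _ : Fin p => μ) j).map_eq] at this

theorem absolutelyContinuous_marginal {p : ℕ} {μ : Measure ℝ} [IsProbabilityMeasure μ]
    {P : Measure (Fin p → ℝ)} (h : (Measure.pi fun _ => μ) ≪ P) (j : Fin p) : μ ≪ marginal P j := by
  have := h.map (measurable_pi_apply j)
  rwa [(measurePreserving_eval (fun _ : Fin p => μ) j).map_eq] at this

theorem integrable_sq_marginal_posterior {μ : Measure ℝ} [IsProbabilityMeasure μ]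
    (hμ2 : Integrable (fun x => x ^ 2) μ) {n p : ℕ} (X : Fin n → Fin p → ℝ) {y : Fin n → ℝ}
    (hy : ∀ i, y i ∈ Set.Icc (0 : ℝ) 1) (j : Fin p) :
    Integrable (fun x => x ^ 2) (marginal (posterior μ X y) j) := by
  rw [marginal, integrable_map_measure (f := fun b : Fin p → ℝ => b j) (by fun_prop)
    (measurable_pi_apply j).aemeasurable, posterior,
    integrable_tilted_iff (integrable_exp_logLik _ X hy)]
  have h2 : Integrable (fun b : Fin p → ℝ => b j ^ 2) (Measure.pi fun _ => μ) :=
    (measurePreserving_eval (fun _ : Fin p => μ) j).integrable_comp_of_integrable hμ2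
  refine h2.bdd_mul (c := 1) ((measurable_logLik X y).exp).aestronglyMeasurable
    (ae_of_all _ fun b => ?_)
  rw [Real.norm_eq_abs, Real.abs_exp]
  exact Real.exp_le_one_iff.mpr (logLik_nonpos X y hy b)

/-- Stability of all the marginals of the posterior under a change of the responses. -/
theorem sum_wasserstein2_marginal_posterior_le {μ : Measure ℝ} [IsProbabilityMeasure μ] {U : ℝ → ℝ}
    (hUc : Continuous U) {m : ℝ} (hm : 0 < m) (hU : StrongConcaveOn Set.univ m U)
    (hμ : μ = (volume : Measure ℝ).withDensity (fun x => ENNReal.ofReal (Real.exp (U x))))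
    {n p : ℕ} (X : Fin n → Fin p → ℝ) {y y' : Fin n → ℝ} (hy : ∀ i, y i ∈ Set.Icc (0 : ℝ) 1)
    (hy' : ∀ i, y' i ∈ Set.Icc (0 : ℝ) 1) :
    ∑ j, wasserstein2 (marginal (posterior μ X y) j) (marginal (posterior μ X y') j) ^ 2 ≤
      ENNReal.ofReal (4 / m ^ 2 * ∑ j, (∑ i, (y' i - y i) * X i j) ^ 2) := by
  have hμ2 : Integrable (fun x => x ^ 2) μ := by
    have h1 : Integrable (fun x => Real.exp (m / 8 * x ^ 2)) μ :=
      ⟨by fun_prop, by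
        rw [hasFiniteIntegral_iff_ofReal (ae_of_all _ fun x => (Real.exp_pos _).le)]
        exact lintegral_exp_sq_lt_top hUc hm hU hμ⟩
    refine (h1.const_mul (8 / m)).mono' (by fun_prop) (ae_of_all _ fun x => ?_)
    rw [Real.norm_eq_abs, abs_of_nonneg (sq_nonneg x)]
    calc x ^ 2 = 8 / m * (m / 8 * x ^ 2) := by field_simp
      _ ≤ _ := by
        gcongr
        linarith [Real.add_one_le_exp (m / 8 * x ^ 2)]
  have hμv : μ ≪ volume := hμ ▸ withDensity_absolutelyContinuous _ _
  have hvμ : volume ≪ μ := hμ ▸ withDensity_absolutelyContinuous' (by fun_prop)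
    (ae_of_all _ fun x => by simp [Real.exp_pos])
  have hprob : ∀ z : Fin n → ℝ, (∀ i, z i ∈ Set.Icc (0 : ℝ) 1) → ∀ j,
      IsProbabilityMeasure (marginal (posterior μ X z) j) := fun z hz j =>
    have := isProbabilityMeasure_posterior μ X z hz
    Measure.isProbabilityMeasure_map (measurable_pi_apply j).aemeasurable
  have hopen : ∀ z : Fin n → ℝ, (∀ i, z i ∈ Set.Icc (0 : ℝ) 1) → ∀ j,
      (marginal (posterior μ X z) j).IsOpenPosMeasure := fun z hz j =>
    (hvμ.trans (absolutelyContinuous_marginal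
      (absolutelyContinuous_tilted (integrable_exp_logLik _ X hz)) j)).isOpenPosMeasure
  have hatom : ∀ z : Fin n → ℝ, ∀ j, NullSingletonClass (marginal (posterior μ X z) j) :=
    fun z j => ⟨fun x => ((marginal_absolutelyContinuous (tilted_absolutelyContinuous _ _) j).trans
      hμv) (by simp)⟩
  have hex : ∀ j, ∃ f g : ℝ → ℝ, Measurable f ∧ Measurable g ∧ (∀ s t, f s + g t ≤ (s - t) ^ 2) ∧
      Integrable f (marginal (posterior μ X y) j) ∧ Integrable g (marginal (posterior μ X y') j) ∧
      0 ≤ ∫ x, f x ∂(marginal (posterior μ X y) j) + ∫ x, g x ∂(marginal (posterior μ X y') j) ∧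
      wasserstein2 (marginal (posterior μ X y) j) (marginal (posterior μ X y') j) ^ 2 ≤
        ENNReal.ofReal (∫ x, f x ∂(marginal (posterior μ X y) j)
          + ∫ x, g x ∂(marginal (posterior μ X y') j)) := fun j => by
    have := hprob y hy j
    have := hprob y' hy' j
    have := hopen y hy j
    have := hopen y' hy' j
    have := hatom y j
    have := hatom y' j
    exact exists_kantorovich_potentials _ _ (integrable_sq_marginal_posterior hμ2 X hy j)
      (integrable_sq_marginal_posterior hμ2 X hy' j)
  choose f g hf hg hfg hfi hgi hnn hW using hex
  refine (Finset.sum_le_sum fun j _ => hW j).trans ?_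
  rw [← ENNReal.ofReal_sum_of_nonneg fun j _ => hnn j]
  refine ENNReal.ofReal_le_ofReal ?_
  have hν := hasCurvedPL_pi (μ := μ) (c := m / 4) (fun u v w hu hv hw h =>
    curved_prekopaLeindler hUc hU hu hv hw h hμ) p
  exact sum_integral_potentials_le hm hν (measurable_logLik X y) (measurable_logLik X y')
    (integrable_exp_logLik _ X hy) (integrable_exp_logLik _ X hy') (logLik_sub X y y')
    (logLik_midpoint X y) hf hg hfg hfi hgi

/-! ### Exchangeability of the coordinates -/

theorem map_tilted_comp {E : Type*} [MeasurableSpace E] {ν : Measure E} (e : E ≃ᵐ E)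
    (he : MeasurePreserving e ν ν) (f : E → ℝ) :
    (ν.tilted fun x => f (e x)).map e = ν.tilted f := by
  ext s hs
  rw [e.map_apply, tilted_apply' _ _ (e.measurable hs), tilted_apply' _ _ hs,
    he.integral_comp' (fun x => Real.exp (f x)),
    he.setLIntegral_comp_preimage_emb e.measurableEmbedding
      (fun x => ENNReal.ofReal (Real.exp (f x) / ∫ z, Real.exp (f z) ∂ν))]

/-- Permutation of the coordinates of a vector: `permute τ b (τ j) = b j`. -/
def permute {p : ℕ} (τ : Equiv.Perm (Fin p)) : (Fin p → ℝ) ≃ᵐ (Fin p → ℝ) :=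
  MeasurableEquiv.piCongrLeft (fun _ => ℝ) τ

theorem permute_apply {p : ℕ} (τ : Equiv.Perm (Fin p)) (b : Fin p → ℝ) (j : Fin p) :
    permute τ b (τ j) = b j :=
  Equiv.piCongrLeft_apply_apply (fun _ => ℝ) τ b j

theorem measurePreserving_permute {p : ℕ} (τ : Equiv.Perm (Fin p)) (μ : Measure ℝ) [SigmaFinite μ] :
    MeasurePreserving (permute τ) (Measure.pi fun _ => μ) (Measure.pi fun _ => μ) :=
  measurePreserving_piCongrLeft (fun _ => μ) τ

theorem linPred_permute {n p : ℕ} (τ : Equiv.Perm (Fin p)) (X : Fin n → Fin p → ℝ) (b : Fin p → ℝ)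
    (i : Fin n) : linPred (fun i => permute τ (X i)) (permute τ b) i = linPred X b i := by
  rw [linPred, ← Equiv.sum_comp τ]
  simp only [permute_apply]
  rfl

theorem marginal_posterior_permute {n p : ℕ} (μ : Measure ℝ) [SigmaFinite μ]
    (τ : Equiv.Perm (Fin p)) (X : Fin n → Fin p → ℝ) (y : Fin n → ℝ) (j : Fin p) :
    marginal (posterior μ (fun i => permute τ (X i)) y) (τ j) = marginal (posterior μ X y) j := by
  have h1 : logLik X y = fun b => logLik (fun i => permute τ (X i)) y (permute τ b) := by
    funext b
    simp only [logLik, linPred_permute]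
  rw [marginal, marginal, posterior, posterior, h1,
    ← map_tilted_comp (permute τ) (measurePreserving_permute τ μ), Measure.map_map
    (measurable_pi_apply _) (permute τ).measurable]
  congr 1
  funext b
  exact permute_apply τ b j

/-- The action of a permutation of the coordinates on the data. -/
def permuteData {n p : ℕ} (τ : Equiv.Perm (Fin p)) :
    ((Fin n → Fin p → ℝ) × (Fin p → ℝ) × (Fin n → ℝ)) ≃ᵐ
      ((Fin n → Fin p → ℝ) × (Fin p → ℝ) × (Fin n → ℝ)) :=
  (MeasurableEquiv.piCongrRight fun _ => permute τ).prodCongr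
    ((permute τ).prodCongr (MeasurableEquiv.refl _))

theorem measurePreserving_permuteData {n p : ℕ} (π : Measure ℝ) [IsProbabilityMeasure π]
    (τ : Equiv.Perm (Fin p)) :
    MeasurePreserving (permuteData (n := n) τ) (dataLaw π n p) (dataLaw π n p) := by
  refine MeasurePreserving.prod ?_ (MeasurePreserving.prod (measurePreserving_permute τ π)
    (MeasurePreserving.id _))
  exact measurePreserving_pi _ _ fun _ => measurePreserving_permute τ _

theorem hardResponse_permute {n p : ℕ} (τ : Equiv.Perm (Fin p)) (X : Fin n → Fin p → ℝ)
    (b : Fin p → ℝ) (e : Fin n → ℝ) :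
    hardResponse (fun i => permute τ (X i)) (permute τ b) e = hardResponse X b e := by
  funext i
  simp only [hardResponse, linPred_permute]

theorem smoothResponse_permute (δ : ℝ) {n p : ℕ} (τ : Equiv.Perm (Fin p)) (X : Fin n → Fin p → ℝ)
    (b : Fin p → ℝ) (e : Fin n → ℝ) :
    smoothResponse δ (fun i => permute τ (X i)) (permute τ b) e = smoothResponse δ X b e := by
  funext i
  simp only [smoothResponse, linPred_permute]

/-- The squared distance between the `j`-th marginals of the posterior and of its smoothed version. -/
def marginalCost (μ : Measure ℝ) (δ : ℝ) {n p : ℕ}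
    (ω : (Fin n → Fin p → ℝ) × (Fin p → ℝ) × (Fin n → ℝ)) (j : Fin p) : ℝ≥0∞ :=
  wasserstein2 (marginal (posterior μ ω.1 (hardResponse ω.1 ω.2.1 ω.2.2)) j)
    (marginal (posterior μ ω.1 (smoothResponse δ ω.1 ω.2.1 ω.2.2)) j) ^ 2

/-- The transposition of `j` and `k` preserves the law of the data, fixes the responses and
exchanges the two marginals. Changing variables along a measurable equivalence requires no
measurability of the cost. -/
theorem lintegral_marginalCost_eq (μ π : Measure ℝ) [SigmaFinite μ] [IsProbabilityMeasure π] (δ : ℝ)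
    {n p : ℕ} (j k : Fin p) :
    ∫⁻ ω, marginalCost μ δ ω j ∂(dataLaw π n p) = ∫⁻ ω, marginalCost μ δ ω k ∂(dataLaw π n p) := by
  set τ := Equiv.swap j k
  rw [← (measurePreserving_permuteData π τ).lintegral_comp_emb
    (permuteData τ).measurableEmbedding fun ω => marginalCost μ δ ω k]
  refine lintegral_congr fun ω => ?_
  have hk : k = τ j := (Equiv.swap_apply_left j k).symm
  obtain ⟨X, b, e⟩ := ω
  change _ = wasserstein2 (marginal (posterior μ (fun i => permute τ (X i))
    (hardResponse (fun i => permute τ (X i)) (permute τ b) e)) k)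
    (marginal (posterior μ (fun i => permute τ (X i))
      (smoothResponse δ (fun i => permute τ (X i)) (permute τ b) e)) k) ^ 2
  rw [hardResponse_permute, smoothResponse_permute, hk, marginal_posterior_permute,
    marginal_posterior_permute]
  rfl

/-- The lower integral is superadditive for arbitrary functions, so measurability of `marginalCost`
in the data is never needed. -/
theorem sum_lintegral_le_lintegral_sum {E ι : Type*} [MeasurableSpace E] (ν : Measure E)
    (s : Finset ι) (f : ι → E → ℝ≥0∞) :
    ∑ j ∈ s, ∫⁻ x, f j x ∂ν ≤ ∫⁻ x, ∑ j ∈ s, f j x ∂ν := by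
  classical
  induction s using Finset.induction_on with
  | empty => simp
  | insert a s ha ih =>
    simp only [Finset.sum_insert ha]
    exact (add_le_add le_rfl ih).trans (le_lintegral_add _ _)

theorem card_mul_lintegral_marginalCost_le (μ π : Measure ℝ) [SigmaFinite μ]
    [IsProbabilityMeasure π] (δ : ℝ) {n p : ℕ} (j₀ : Fin p) :
    (p : ℝ≥0∞) * ∫⁻ ω, marginalCost μ δ ω j₀ ∂(dataLaw π n p) ≤
      ∫⁻ ω, ∑ j, marginalCost μ δ ω j ∂(dataLaw π n p) := by
  refine le_trans (le_of_eq ?_) (sum_lintegral_le_lintegral_sum _ _ _)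
  simp [lintegral_marginalCost_eq μ π δ _ j₀]

/-! ### The smoothing error of a single response -/

/-- The difference of the smoothed and the hard response, as a function of the linear predictor `t`
and of the uniform variable `e`. -/
def responseGap (δ t e : ℝ) : ℝ :=
  smoothStep δ (t - logit e) - Set.indicator (Set.Ici (logit e)) 1 t

theorem smoothStep_mem (δ x : ℝ) : smoothStep δ x ∈ Set.Icc (0 : ℝ) 1 := by
  have h1 := Real.tanh_lt_one (x / δ)
  have h2 := Real.neg_one_lt_tanh (x / δ)
  unfold smoothStep
  constructor <;> linarith

theorem abs_responseGap_le_one (δ t e : ℝ) : |responseGap δ t e| ≤ 1 := by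
  obtain ⟨h1, h2⟩ := smoothStep_mem δ (t - logit e)
  rw [responseGap, Set.indicator_apply, abs_le]
  split_ifs <;> constructor <;> simp <;> linarith

theorem measurable_smoothStep (δ : ℝ) : Measurable (smoothStep δ) := by
  unfold smoothStep
  simp only [Real.tanh_eq_sinh_div_cosh]
  fun_prop

theorem measurable_logit : Measurable logit := by
  unfold logit
  fun_prop

theorem measurable_responseGap (δ : ℝ) : Measurable fun z : ℝ × ℝ => responseGap δ z.1 z.2 := by
  unfold responseGap
  refine Measurable.sub ((measurable_smoothStep δ).comp
    (measurable_fst.sub (measurable_logit.comp measurable_snd))) ?_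
  simp only [Set.indicator_apply, Set.mem_Ici, Pi.one_apply]
  exact Measurable.ite (measurableSet_le (measurable_logit.comp measurable_snd) measurable_fst)
    measurable_const measurable_const

theorem sq_half_one_sub_tanh_le {r : ℝ} (hr : 0 ≤ r) :
    ((1 - Real.tanh r) / 2) ^ 2 ≤ (1 + r ^ 2)⁻¹ := by
  have h : (1 - Real.tanh r) / 2 = (1 + Real.exp r ^ 2)⁻¹ := by
    rw [Real.tanh_eq_sinh_div_cosh, Real.sinh_eq, Real.cosh_eq, Real.exp_neg]
    have := Real.exp_pos r
    field_simp
    ring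
  rw [h, inv_pow]
  have h1 : r + 1 ≤ Real.exp r := Real.add_one_le_exp r
  gcongr
  have h2 : (r + 1) ^ 2 ≤ Real.exp r ^ 2 := by gcongr
  nlinarith [sq_nonneg (Real.exp r ^ 2)]

theorem sq_responseGap_le {δ : ℝ} (hδ : 0 < δ) (t e : ℝ) :
    responseGap δ t e ^ 2 ≤ (1 + ((t - logit e) / δ) ^ 2)⁻¹ := by
  rw [responseGap, Set.indicator_apply, smoothStep]
  split_ifs with h
  · have h : logit e ≤ t := h
    have := sq_half_one_sub_tanh_le (div_nonneg (sub_nonneg.mpr h) hδ.le)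
    refine le_trans (le_of_eq ?_) this
    simp only [Pi.one_apply]
    ring
  · have h : t < logit e := lt_of_not_ge h
    have := sq_half_one_sub_tanh_le (r := -((t - logit e) / δ))
      (by rw [← neg_div]; exact div_nonneg (by linarith) hδ.le)
    rw [Real.tanh_neg, neg_sq] at this
    refine le_trans (le_of_eq ?_) this
    ring

theorem abs_sigmoid_sub_le (s t : ℝ) : |Real.sigmoid s - Real.sigmoid t| ≤ |s - t| := by
  have := Convex.norm_image_sub_le_of_norm_deriv_le (f := Real.sigmoid) (s := Set.univ) (x := t)
    (y := s) (C := 1) (fun x _ => differentiableAt_sigmoid) (fun x _ => by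
      rw [Real.deriv_sigmoid, Real.norm_eq_abs, abs_le]
      have := Real.sigmoid_pos x
      have := Real.sigmoid_lt_one x
      constructor <;> nlinarith) convex_univ trivial trivial
  simpa using this

/-- The law of the uniform variables. -/
abbrev unif : Measure ℝ := (volume : Measure ℝ).restrict (Set.Icc 0 1)

instance : IsProbabilityMeasure unif := ⟨by simp⟩

theorem integrable_sq_responseGap (δ t : ℝ) : Integrable (fun e => responseGap δ t e ^ 2) unif := by
  refine Integrable.of_bound (C := 1)
    (((measurable_responseGap δ).comp measurable_prodMk_left).pow_const 2).aestronglyMeasurable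
    (ae_of_all _ fun e => ?_)
  rw [Real.norm_eq_abs, abs_pow]
  exact pow_le_one₀ (abs_nonneg _) (abs_responseGap_le_one δ t e)

theorem integral_sq_responseGap_le_one (δ t : ℝ) : ∫ e, responseGap δ t e ^ 2 ∂unif ≤ 1 := by
  calc ∫ e, responseGap δ t e ^ 2 ∂unif ≤ ∫ _, (1 : ℝ) ∂unif :=
        integral_mono (integrable_sq_responseGap δ t) (integrable_const _) fun e => by
          rw [← sq_abs]
          exact pow_le_one₀ (abs_nonneg _) (abs_responseGap_le_one δ t e)
    _ = 1 := by simp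

/-- The sigmoid is 1-Lipschitz, so `|e - σ(t)| ≤ |t - logit e|`. The squared gap is thus dominated
by an unnormalized Cauchy density of scale `δ` in `e`, whose total mass is `π δ` whatever the
predictor `t`. -/
theorem integral_sq_responseGap_le {δ : ℝ} (hδ : 0 < δ) (t : ℝ) :
    ∫ e, responseGap δ t e ^ 2 ∂unif ≤ Real.pi * δ := by
  have hi : Integrable fun e : ℝ => (1 + ((e - Real.sigmoid t) / δ) ^ 2)⁻¹ :=
    (integrable_inv_one_add_sq.comp_div hδ.ne').comp_sub_right (Real.sigmoid t)
  calc ∫ e, responseGap δ t e ^ 2 ∂unif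
      ≤ ∫ e, (1 + ((e - Real.sigmoid t) / δ) ^ 2)⁻¹ ∂unif := by
        refine integral_mono_ae (integrable_sq_responseGap δ t) hi.restrict ?_
        have h01 : ∀ᵐ e ∂unif, e ∈ Set.Ioo (0 : ℝ) 1 := by
          rw [unif, ← restrict_Ioo_eq_restrict_Icc]
          exact ae_restrict_mem measurableSet_Ioo
        filter_upwards [h01] with e he
        refine (sq_responseGap_le hδ t e).trans ?_
        have h1 := abs_sigmoid_sub_le t (logit e)
        rw [sigmoid_logit he.1 he.2] at h1
        have h2 : (e - Real.sigmoid t) ^ 2 ≤ (t - logit e) ^ 2 := by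
          rw [← sq_abs, ← sq_abs (t - logit e), abs_sub_comm]
          gcongr
        simp only [div_pow]
        gcongr
    _ ≤ ∫ e, (1 + ((e - Real.sigmoid t) / δ) ^ 2)⁻¹ :=
        setIntegral_le_integral hi (ae_of_all _ fun e => by positivity)
    _ = Real.pi * δ := by
        rw [integral_sub_right_eq_self (fun e : ℝ => (1 + (e / δ) ^ 2)⁻¹) (Real.sigmoid t),
          Measure.integral_comp_div (fun e : ℝ => (1 + e ^ 2)⁻¹), integral_univ_inv_one_add_sq,
          abs_of_pos hδ, smul_eq_mul, mul_comm]

/-! ### Second moments of sums of independent variables -/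

theorem integral_sq_sum_pi_le {S : Type*} [MeasurableSpace S] {ρ : Measure S}
    [IsProbabilityMeasure ρ] {ξ : S → ℝ} (hξ : MemLp ξ 2 ρ) (n : ℕ) :
    Integrable (fun s : Fin n → S => (∑ i, ξ (s i)) ^ 2) (Measure.pi fun _ => ρ) ∧
    ∫ s : Fin n → S, (∑ i, ξ (s i)) ^ 2 ∂(Measure.pi fun _ => ρ) ≤
      n * ∫ s, ξ s ^ 2 ∂ρ + n ^ 2 * (∫ s, ξ s ∂ρ) ^ 2 := by
  have hi : ∀ i : Fin n, MemLp (fun s : Fin n → S => ξ (s i)) 2 (Measure.pi fun _ => ρ) :=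
    fun i => hξ.comp_measurePreserving (measurePreserving_eval _ i)
  have hS : MemLp (fun s : Fin n → S => ∑ i, ξ (s i)) 2 (Measure.pi fun _ => ρ) :=
    memLp_finsetSum _ fun i _ => hi i
  have hvar := variance_sum_pi (μ := fun _ : Fin n => ρ) (X := fun _ => ξ) fun _ => hξ
  have hfun : (∑ i, fun s : Fin n → S => ξ (s i)) = fun s => ∑ i, ξ (s i) := by
    funext s; simp
  rw [hfun, variance_eq_sub hS, variance_eq_sub hξ] at hvar
  have hmean : ∫ s : Fin n → S, ∑ i, ξ (s i) ∂(Measure.pi fun _ => ρ) = n * ∫ s, ξ s ∂ρ := by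
    rw [integral_finsetSum _ fun i _ => (hi i).integrable (by norm_num)]
    simp [integral_comp_eval (μ := fun _ : Fin n => ρ) hξ.1]
  refine ⟨hS.integrable_sq, ?_⟩
  rw [hmean] at hvar
  simp only [Pi.pow_apply, Finset.sum_const, Finset.card_univ, Fintype.card_fin, nsmul_eq_mul] at hvar
  have : (0 : ℝ) ≤ n * (∫ s, ξ s ∂ρ) ^ 2 := by positivity
  nlinarith

/-! ### The gradient of the log-likelihood gap -/

/-- The law of a row of the design matrix. -/
abbrev rowLaw (n p : ℕ) : Measure (Fin p → ℝ) :=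
  Measure.pi fun _ : Fin p => gaussianReal 0 ((n : ℝ≥0)⁻¹)

theorem memLp_row (n p : ℕ) (j : Fin p) : MemLp (fun x : Fin p → ℝ => x j) 2 (rowLaw n p) :=
  (memLp_id_gaussianReal' 2 (by simp)).comp_measurePreserving
    (measurePreserving_eval (fun _ : Fin p => gaussianReal 0 ((n : ℝ≥0)⁻¹)) j)

theorem integral_sq_linear_row (n p : ℕ) (a : Fin p → ℝ) :
    ∫ x, (∑ j, a j * x j) ^ 2 ∂(rowLaw n p) = (∑ j, a j ^ 2) / n := by
  have hg : MemLp (fun t : ℝ => t) 2 (gaussianReal 0 ((n : ℝ≥0)⁻¹)) :=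
    memLp_id_gaussianReal' 2 (by simp)
  have hv := variance_sum_pi (μ := fun _ : Fin p => gaussianReal 0 ((n : ℝ≥0)⁻¹))
    (X := fun j t => a j * t) fun j => hg.const_mul (a j)
  have hfun : (∑ j, fun x : Fin p → ℝ => a j * x j) = fun x => ∑ j, a j * x j := by
    funext x; simp
  have hm : MemLp (fun x : Fin p → ℝ => ∑ j, a j * x j) 2 (rowLaw n p) :=
    memLp_finsetSum _ fun j _ => (memLp_row n p j).const_mul (a j)
  have hmean : ∫ x, ∑ j, a j * x j ∂(rowLaw n p) = 0 := by
    rw [integral_finsetSum _ fun j _ => ((memLp_row n p j).const_mul (a j)).integrable (by norm_num)]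
    refine Finset.sum_eq_zero fun j _ => ?_
    rw [integral_const_mul, integral_eval (μ := fun _ : Fin p => gaussianReal 0 ((n : ℝ≥0)⁻¹)),
      integral_id_gaussianReal, mul_zero]
  rw [hfun, variance_eq_sub hm, hmean] at hv
  simp only [Pi.pow_apply] at hv
  have hj : ∀ j, Var[fun t => a j * t; gaussianReal 0 ((n : ℝ≥0)⁻¹)] = a j ^ 2 * (n : ℝ)⁻¹ := by
    intro j
    rw [variance_const_mul]
    congr 1
    exact variance_id_gaussianReal.trans (by simp)
  simp only [hj] at hv
  rw [← Finset.sum_mul] at hv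
  rw [div_eq_mul_inv]
  linarith

theorem integral_sq_row (n p : ℕ) (j : Fin p) : ∫ x, x j ^ 2 ∂(rowLaw n p) = 1 / n := by
  have := integral_sq_linear_row n p (Pi.single j 1)
  simpa [Pi.single_apply, Finset.sum_ite_eq'] using this

/-- The gap of a response, as a function of the row of the design and of the uniform variable. -/
def rowGap (δ : ℝ) {p : ℕ} (β : Fin p → ℝ) (z : (Fin p → ℝ) × ℝ) : ℝ :=
  responseGap δ (∑ j, z.1 j * β j) z.2

theorem measurable_rowGap (δ : ℝ) {p : ℕ} (β : Fin p → ℝ) : Measurable (rowGap δ β) :=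
  (measurable_responseGap δ).comp (f := fun z : (Fin p → ℝ) × ℝ => (∑ j, z.1 j * β j, z.2))
    (by fun_prop)

theorem abs_rowGap_le_one (δ : ℝ) {p : ℕ} (β : Fin p → ℝ) (z : (Fin p → ℝ) × ℝ) :
    |rowGap δ β z| ≤ 1 := abs_responseGap_le_one _ _ _

theorem memLp_rowGap (δ : ℝ) (n : ℕ) {p : ℕ} (β : Fin p → ℝ) :
    MemLp (rowGap δ β) 2 ((rowLaw n p).prod unif) :=
  MemLp.of_bound (measurable_rowGap δ β).aestronglyMeasurable 1
    (ae_of_all _ fun z => abs_rowGap_le_one δ β z)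

theorem memLp_fst_row (n p : ℕ) (j : Fin p) :
    MemLp (fun z : (Fin p → ℝ) × ℝ => z.1 j) 2 ((rowLaw n p).prod unif) :=
  (memLp_row n p j).comp_measurePreserving measurePreserving_fst

theorem memLp_rowGap_mul (δ : ℝ) (n : ℕ) {p : ℕ} (β : Fin p → ℝ) (j : Fin p) :
    MemLp (fun z => rowGap δ β z * z.1 j) 2 ((rowLaw n p).prod unif) := by
  refine (memLp_fst_row n p j).mono (((measurable_rowGap δ β).mul
    ((measurable_pi_apply j).comp measurable_fst)).aestronglyMeasurable) (ae_of_all _ fun z => ?_)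
  rw [norm_mul]
  exact mul_le_of_le_one_left (norm_nonneg _) (abs_rowGap_le_one δ β z)

/-- The uniform variable is integrated first, with the row fixed; `hD` is uniform in the linear
predictor, so the dependence of the gap on the row does no harm. -/
theorem integral_sq_rowGap_mul_le {δ D : ℝ} (hD : ∀ t, ∫ e, responseGap δ t e ^ 2 ∂unif ≤ D) (n : ℕ)
    {p : ℕ} (β : Fin p → ℝ) {q : (Fin p → ℝ) → ℝ} (hq : MemLp q 2 (rowLaw n p))
    (hqm : Measurable q) :
    ∫ z, (rowGap δ β z * q z.1) ^ 2 ∂((rowLaw n p).prod unif) ≤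
      D * ∫ x, q x ^ 2 ∂(rowLaw n p) := by
  have hq' : MemLp (fun z : (Fin p → ℝ) × ℝ => q z.1) 2 ((rowLaw n p).prod unif) :=
    hq.comp_measurePreserving measurePreserving_fst
  have hm : Measurable fun z => rowGap δ β z * q z.1 :=
    (measurable_rowGap δ β).mul (hqm.comp measurable_fst)
  have hi : MemLp (fun z => rowGap δ β z * q z.1) 2 ((rowLaw n p).prod unif) := by
    refine hq'.mono hm.aestronglyMeasurable (ae_of_all _ fun z => ?_)
    rw [norm_mul]
    exact mul_le_of_le_one_left (norm_nonneg _) (abs_rowGap_le_one δ β z)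
  have hi2 := hi.integrable_sq
  have hx : ∀ x : Fin p → ℝ, ∫ e, (rowGap δ β (x, e) * q x) ^ 2 ∂unif ≤ D * q x ^ 2 := fun x => by
    simp only [mul_pow, integral_mul_const]
    exact mul_le_mul_of_nonneg_right (hD (∑ j, x j * β j)) (sq_nonneg (q x))
  calc ∫ z, (rowGap δ β z * q z.1) ^ 2 ∂((rowLaw n p).prod unif)
      = ∫ x, ∫ e, (rowGap δ β (x, e) * q x) ^ 2 ∂unif ∂(rowLaw n p) := integral_prod _ hi2
    _ ≤ ∫ x, D * q x ^ 2 ∂(rowLaw n p) :=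
        integral_mono hi2.integral_prod_left (hq.integrable_sq.const_mul D) hx
    _ = D * ∫ x, q x ^ 2 ∂(rowLaw n p) := integral_const_mul _ _

/-- Bessel's inequality for the correlations of the gap with the coordinates of the row. -/
theorem sum_sq_integral_rowGap_mul_le {δ D : ℝ}
    (hD : ∀ t, ∫ e, responseGap δ t e ^ 2 ∂unif ≤ D) {n : ℕ} (hn : 1 ≤ n) {p : ℕ}
    (β : Fin p → ℝ) :
    n * ∑ j, (∫ z, rowGap δ β z * z.1 j ∂((rowLaw n p).prod unif)) ^ 2 ≤ D := by
  set ρ := (rowLaw n p).prod unif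
  set a : Fin p → ℝ := fun j => ∫ z, rowGap δ β z * z.1 j ∂ρ with ha
  have hn0 : (0 : ℝ) < n := by exact_mod_cast hn
  have hd := memLp_rowGap δ n β
  have hd2 : ∫ z, rowGap δ β z ^ 2 ∂ρ ≤ D := by
    have := integral_sq_rowGap_mul_le hD n β (q := fun _ => 1) (memLp_const 1) measurable_const
    simpa using this
  have hL : MemLp (fun z : (Fin p → ℝ) × ℝ => ∑ j, a j * z.1 j) 2 ρ :=
    memLp_finsetSum _ fun j _ => (memLp_fst_row n p j).const_mul (a j)
  have hL2 : ∫ z, (∑ j, a j * z.1 j) ^ 2 ∂ρ = (∑ j, a j ^ 2) / n := by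
    rw [← integral_sq_linear_row n p a]
    have := integral_fun_fst (μ := rowLaw n p) (ν := unif) fun x : Fin p → ℝ =>
      (∑ j, a j * x j) ^ 2
    simpa using this
  have hdx : ∀ j, Integrable (fun z => rowGap δ β z * z.1 j) ρ := fun j =>
    (memLp_rowGap_mul δ n β j).integrable (by norm_num)
  have hdL : ∫ z, rowGap δ β z * ∑ j, a j * z.1 j ∂ρ = ∑ j, a j ^ 2 := by
    have e : ∀ z : (Fin p → ℝ) × ℝ, rowGap δ β z * ∑ j, a j * z.1 j =
        ∑ j, a j * (rowGap δ β z * z.1 j) := fun z => by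
      rw [Finset.mul_sum]; exact Finset.sum_congr rfl fun j _ => by ring
    simp only [e]
    rw [integral_finsetSum _ fun j _ => (hdx j).const_mul (a j)]
    simp only [integral_const_mul]
    exact Finset.sum_congr rfl fun j _ => by rw [sq]
  have hdLi : Integrable (fun z => rowGap δ β z * ∑ j, a j * z.1 j) ρ := hd.integrable_mul hL
  -- The coordinates of the row are orthogonal with second moment `1 / n`, so `n * a j` are the
  -- coefficients of the orthogonal projection of the gap onto their span.
  have hpos : 0 ≤ ∫ z, (rowGap δ β z - n * ∑ j, a j * z.1 j) ^ 2 ∂ρ :=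
    integral_nonneg fun z => sq_nonneg _
  have hexp : ∀ z : (Fin p → ℝ) × ℝ, (rowGap δ β z - n * ∑ j, a j * z.1 j) ^ 2 =
      rowGap δ β z ^ 2 - 2 * n * (rowGap δ β z * ∑ j, a j * z.1 j)
        + n ^ 2 * (∑ j, a j * z.1 j) ^ 2 := fun z => by ring
  simp only [hexp] at hpos
  have hsub : Integrable (fun z => rowGap δ β z ^ 2 -
      2 * n * (rowGap δ β z * ∑ j, a j * z.1 j)) ρ := hd.integrable_sq.sub (hdLi.const_mul _)
  rw [integral_add hsub (hL.integrable_sq.const_mul _),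
    integral_sub hd.integrable_sq (hdLi.const_mul _), integral_const_mul, integral_const_mul, hdL,
    hL2] at hpos
  have : (n : ℝ) ^ 2 * ((∑ j, a j ^ 2) / n) = n * ∑ j, a j ^ 2 := by field_simp
  rw [this] at hpos
  change (n : ℝ) * ∑ j, a j ^ 2 ≤ D
  linarith

theorem measurable_responses (δ : ℝ) {n p : ℕ} (i : Fin n) :
    Measurable fun ω : (Fin n → Fin p → ℝ) × (Fin p → ℝ) × (Fin n → ℝ) =>
      smoothResponse δ ω.1 ω.2.1 ω.2.2 i - hardResponse ω.1 ω.2.1 ω.2.2 i := by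
  refine (measurable_responseGap δ).comp (f := fun ω : (Fin n → Fin p → ℝ) × (Fin p → ℝ) ×
    (Fin n → ℝ) => (linPred ω.1 ω.2.1 i, ω.2.2 i)) ?_
  unfold linPred
  fun_prop

/-- The expected squared norm of the gradient of the log-likelihood gap. -/
theorem lintegral_sq_gradient_le {δ D : ℝ} (hD : ∀ t, ∫ e, responseGap δ t e ^ 2 ∂unif ≤ D)
    {n : ℕ} (hn : 1 ≤ n) (p : ℕ) (π : Measure ℝ) [IsProbabilityMeasure π] :
    ∫⁻ ω, ENNReal.ofReal (∑ j, (∑ i, (smoothResponse δ ω.1 ω.2.1 ω.2.2 i -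
      hardResponse ω.1 ω.2.1 ω.2.2 i) * ω.1 i j) ^ 2) ∂(dataLaw π n p) ≤
      ENNReal.ofReal ((p + n) * D) := by
  have hn0 : (0 : ℝ) < n := by exact_mod_cast hn
  have hmeas : Measurable fun ω : (Fin n → Fin p → ℝ) × (Fin p → ℝ) × (Fin n → ℝ) =>
      ENNReal.ofReal (∑ j, (∑ i, (smoothResponse δ ω.1 ω.2.1 ω.2.2 i -
        hardResponse ω.1 ω.2.1 ω.2.2 i) * ω.1 i j) ^ 2) := by
    refine ENNReal.measurable_ofReal.comp (Finset.measurable_sum _ fun j _ =>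
      (Finset.measurable_sum _ fun i _ => (measurable_responses δ i).mul ?_).pow_const 2)
    fun_prop
  have hX : Measurable fun z : ((Fin n → Fin p → ℝ) × (Fin p → ℝ)) × (Fin n → ℝ) =>
      (z.1.1, z.1.2, z.2) := by fun_prop
  rw [dataLaw, lintegral_prod _ hmeas.aemeasurable]
  have h1 : ∀ X : Fin n → Fin p → ℝ, ∫⁻ w, ENNReal.ofReal (∑ j, (∑ i, (smoothResponse δ X w.1 w.2 i -
        hardResponse X w.1 w.2 i) * X i j) ^ 2)
        ∂((Measure.pi fun _ : Fin p => π).prod (Measure.pi fun _ : Fin n => unif)) =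
      ∫⁻ β, ∫⁻ e, ENNReal.ofReal (∑ j, (∑ i, (smoothResponse δ X β e i -
        hardResponse X β e i) * X i j) ^ 2) ∂(Measure.pi fun _ : Fin n => unif)
        ∂(Measure.pi fun _ : Fin p => π) := fun X =>
    lintegral_prod _ (hmeas.comp measurable_prodMk_left).aemeasurable
  -- The signal is moved to the outermost integral: once it is fixed, the pairs of a row and its
  -- uniform variable are i.i.d.
  rw [lintegral_congr h1, lintegral_lintegral_swap
    (hmeas.comp hX).lintegral_prod_right'.aemeasurable]
  refine (lintegral_mono (g := fun _ => ENNReal.ofReal ((p + n) * D)) fun β => ?_).trans (by simp)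
  have hXe : Measurable fun z : (Fin n → Fin p → ℝ) × (Fin n → ℝ) => (z.1, β, z.2) := by fun_prop
  refine (lintegral_prod _ (hmeas.comp hXe).aemeasurable).symm.le.trans ?_
  have hmp := measurePreserving_arrowProdEquivProdArrow (Fin p → ℝ) ℝ (Fin n)
    (fun _ => rowLaw n p) (fun _ => unif)
  rw [← hmp.lintegral_comp_emb (MeasurableEquiv.measurableEmbedding _)]
  have hint := fun j : Fin p => integral_sq_sum_pi_le (memLp_rowGap_mul δ n β j) n
  calc _ = ∫⁻ s : Fin n → (Fin p → ℝ) × ℝ,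
        ENNReal.ofReal (∑ j, (∑ i, rowGap δ β (s i) * (s i).1 j) ^ 2)
        ∂(Measure.pi fun _ => (rowLaw n p).prod unif) := rfl
    _ = ENNReal.ofReal (∑ j, ∫ s : Fin n → (Fin p → ℝ) × ℝ,
        (∑ i, rowGap δ β (s i) * (s i).1 j) ^ 2
        ∂(Measure.pi fun _ => (rowLaw n p).prod unif)) := by
        rw [← integral_finsetSum _ fun j _ => (hint j).1, ofReal_integral_eq_lintegral_ofReal
          (integrable_finsetSum _ fun j _ => (hint j).1)
          (ae_of_all _ fun s => Finset.sum_nonneg fun j _ => sq_nonneg _)]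
    _ ≤ ENNReal.ofReal ((p + n) * D) := by
        refine ENNReal.ofReal_le_ofReal ((Finset.sum_le_sum fun j _ => (hint j).2).trans ?_)
        rw [Finset.sum_add_distrib, ← Finset.mul_sum, ← Finset.mul_sum]
        -- The second moments contribute `n * (p * (D / n)) = p * D`, the squared means `n * (n * ∑
        -- j, mean²) ≤ n * D`. Without Bessel's inequality, bounding each mean separately would cost
        -- `n * p * D`.
        have hdiag : ∑ j : Fin p, ∫ z, (rowGap δ β z * z.1 j) ^ 2 ∂((rowLaw n p).prod unif) ≤
            p * (D / n) := by
          refine (Finset.sum_le_sum fun j _ => integral_sq_rowGap_mul_le hD n β (memLp_row n p j)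
            (measurable_pi_apply j)).trans (le_of_eq ?_)
          simp only [integral_sq_row, Finset.sum_const, Finset.card_univ, Fintype.card_fin,
            nsmul_eq_mul]
          ring
        have hoff := sum_sq_integral_rowGap_mul_le hD hn β
        have h2 := mul_le_mul_of_nonneg_left hdiag hn0.le
        have h3 := mul_le_mul_of_nonneg_left hoff hn0.le
        have h4 : (n : ℝ) * (p * (D / n)) = p * D := by field_simp
        rw [h4] at h2
        linarith

/-- The argument yields the stronger rate `min 1 (c * δ)`; the power `1 / 4` is reached only by
weakening it, separately for `δ ≤ 1` and `δ ≥ 1`. -/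
theorem min_one_mul_le_rpow {c δ : ℝ} (hc : 1 ≤ c) (hδ : 0 < δ) :
    min 1 (c * δ) ≤ c * δ ^ (1 / 4 : ℝ) := by
  rcases le_total δ 1 with h | h
  · refine (min_le_right _ _).trans (mul_le_mul_of_nonneg_left ?_ (by linarith))
    exact Real.self_le_rpow_of_le_one hδ.le h (by norm_num)
  · refine (min_le_left _ _).trans ?_
    have := Real.one_le_rpow h (show (0 : ℝ) ≤ 1 / 4 by norm_num)
    nlinarith

theorem exists_nat_cast_le_mul {p : ℕ → ℕ} {κ : ℝ} (hκ : 0 < κ)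
    (hp : Tendsto (fun n : ℕ => (p n : ℝ) / (n : ℝ)) atTop (𝓝 κ)) :
    ∃ K : ℝ, 0 < K ∧ ∀ n, 0 < p n → (n : ℝ) ≤ K * p n := by
  -- A convergent sequence is bounded along all of its terms, so the comparison holds for every `n`
  -- and not only for large `n`.
  obtain ⟨K, hK⟩ := (hp.inv₀ hκ.ne').bddAbove_range
  refine ⟨max K 1, by positivity, fun n hn => ?_⟩
  have h : ((p n : ℝ) / n)⁻¹ ≤ K := hK ⟨n, rfl⟩
  have hn' : (0 : ℝ) < p n := by exact_mod_cast hn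
  rw [inv_div, div_le_iff₀ hn'] at h
  exact h.trans (mul_le_mul_of_nonneg_right (le_max_left _ _) hn'.le)

end LogisticSmoothing

end

/-! ### Assembly of the bound -/

theorem mainTheorem8
    -- the prior and the law of the signal coordinates
    (μ π : Measure ℝ) (hμ : LogisticSmoothing.IsStronglyLogConcavePrior μ)
    (hπ : IsProbabilityMeasure π)
    -- the proportional regime
    (p : ℕ → ℕ) (κ : ℝ) (hκ : 0 < κ)
    (hp : Tendsto (fun n : ℕ => (p n : ℝ) / (n : ℝ)) atTop (𝓝 κ)) :
    ∃ C : ℝ, 0 < C ∧ ∀ n : ℕ, 1 ≤ n → ∀ δ : ℝ, 0 < δ → ∀ j₀ : Fin (p n),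
      ∫⁻ ω, LogisticSmoothing.wasserstein2
          (LogisticSmoothing.marginal (LogisticSmoothing.posterior μ ω.1
            (LogisticSmoothing.hardResponse ω.1 ω.2.1 ω.2.2)) j₀)
          (LogisticSmoothing.marginal (LogisticSmoothing.posterior μ ω.1
            (LogisticSmoothing.smoothResponse δ ω.1 ω.2.1 ω.2.2)) j₀) ^ 2
        ∂(LogisticSmoothing.dataLaw π n (p n))
      ≤ ENNReal.ofReal (C * δ ^ (1 / 4 : ℝ)) := by
  obtain ⟨hμp, U, hU2, ⟨m, hm, hU⟩, hμU⟩ := hμ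
  obtain ⟨K, hK0, hK⟩ := LogisticSmoothing.exists_nat_cast_le_mul hκ hp
  have hpi : 1 ≤ Real.pi := by linarith [Real.pi_gt_three]
  -- The factor `4 / m ^ 2` comes from stability under tilts, `1 + K` bounds `(p + n) / p`, and `π`
  -- is the mass of the Cauchy density.
  refine ⟨4 / m ^ 2 * ((1 + K) * Real.pi), by positivity, fun n hn δ hδ j₀ => ?_⟩
  have hpn : 0 < p n := j₀.pos
  have hpn' : (0 : ℝ) < p n := by exact_mod_cast hpn
  set D := Real.pi * δ ^ (1 / 4 : ℝ) with hDdef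
  have hD0 : 0 ≤ D := by positivity
  have hD : ∀ t, ∫ e, LogisticSmoothing.responseGap δ t e ^ 2 ∂LogisticSmoothing.unif ≤ D := fun t =>
    (le_min (LogisticSmoothing.integral_sq_responseGap_le_one δ t)
      (LogisticSmoothing.integral_sq_responseGap_le hδ t)).trans
      (LogisticSmoothing.min_one_mul_le_rpow hpi hδ)
  have h1 := LogisticSmoothing.card_mul_lintegral_marginalCost_le μ π δ (n := n) j₀
  have h2 : ∫⁻ ω, ∑ j, LogisticSmoothing.marginalCost μ δ ω j
      ∂(LogisticSmoothing.dataLaw π n (p n)) ≤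
      ENNReal.ofReal (4 / m ^ 2) * ENNReal.ofReal ((p n + n) * D) := by
    refine le_trans ?_ (mul_le_mul_right (LogisticSmoothing.lintegral_sq_gradient_le hD hn (p n) π) _)
    rw [← lintegral_const_mul' _ _ ENNReal.ofReal_ne_top]
    refine lintegral_mono fun ω => ?_
    rw [← ENNReal.ofReal_mul (by positivity)]
    exact LogisticSmoothing.sum_wasserstein2_marginal_posterior_le hU2.continuous hm hU hμU ω.1
      (LogisticSmoothing.hardResponse_mem _ _ _) (LogisticSmoothing.smoothResponse_mem _ _ _ _)
  have h3 : ENNReal.ofReal (4 / m ^ 2) * ENNReal.ofReal ((p n + n) * D) ≤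
      (p n : ℝ≥0∞) * ENNReal.ofReal (4 / m ^ 2 * ((1 + K) * Real.pi) * δ ^ (1 / 4 : ℝ)) := by
    rw [← ENNReal.ofReal_natCast, ← ENNReal.ofReal_mul (by positivity),
      ← ENNReal.ofReal_mul (by positivity)]
    refine ENNReal.ofReal_le_ofReal ?_
    have : (p n + n : ℝ) * D ≤ (p n + K * p n) * D := by
      gcongr
      exact hK n hpn
    calc 4 / m ^ 2 * ((p n + n) * D) ≤ 4 / m ^ 2 * ((p n + K * p n) * D) := by gcongr
      _ = _ := by rw [hDdef]; ring
  refine (ENNReal.mul_le_mul_iff_right (a := (p n : ℝ≥0∞)) (by exact_mod_cast hpn.ne')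
    (ENNReal.natCast_ne_top _)).mp ?_
  exact h1.trans (h2.trans h3)
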